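/- Let $k\in\{2,3\}$ and let $\mathbb T^k$ be the rooted Cayley tree of order $k$ with root $0$: every vertex other than the root has $k$ direct successors, and the root has either $k+1$ successors (the $(k+1)$-regular tree) or $k$ successors; the statement holds in both cases. Let $W_n$, $V_n$ be the sets of vertices at distance $n$, respectively at most $n$, from $0$, and put $\Omega=\{-1,0,1\}^{\mathbb T^k}$. Let $J>0$, $\beta>0$, $\lambda>0$ and $\theta=e^{-J\beta}\in(0,1)$. The (ferromagnetic soft-core) Widom–Rowlinson model has Hamiltonian $$H(\omega)=J\sum_{\{i,j\}}\mathbf 1(\omega_i\omega_j=-1)-\frac{\ln\lambda}{\beta}\sum_i\omega_i^2 ,$$ the first sum being over edges. Let $H_n$ be its restriction to the vertices of $V_n$ and the edges inside $V_n$. A Gibbs measure is a probability measure $\mu$ on $\Omega$ satisfying the DLR equations for $H$: for every finite set $\Lambda$ of vertices, $\mu(A)=\int\gamma_\Lambda(A\mid\omega)\,\mu(d\omega)$ for all events $A$, where $\gamma_\Lambda(\cdot\mid\omega)$ is the Boltzmann distribution at inverse temperature $\beta$ in $\Lambda$ with boundary condition $\omega$. A Gibbs measure is extreme if it is an extreme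 point of the convex set of all Gibbs measures. For $x,y>0$, the translation-invariant splitting Gibbs measure (TISGM) with boundary law $(x,y)$ is the probability measure on $\Omega$ whose marginal on $\{-1,0,1\}^{V_n}$ is, for every $n\ge 1$, $$\mu_n(\omega)=\frac1{Z_n}\exp\Big(-\beta H_n(\omega)+\sum_{i\in W_n}h_{\omega_i}\Big),$$ where $h=(h_{-1},h_0,h_1)\in\mathbb R^3$ satisfies $x=\lambda e^{h_1-h_0}$ and $y=\lambda e^{h_{-1}-h_0}$. **Theorem.** Suppose $$\theta<\theta_c(k)=\frac{k-1}{k+1},\qquad \lambda>\lambda_{\rm cr}(k)=\frac1{k-1-\theta(k+1)}\Big(\frac{k+1}{k}\Big)^k .$$ Then the system $$x=\lambda\Big(\frac{1+x+\theta y}{1+x+y}\Big)^k,\qquad y=\lambda\Big(\frac{1+\theta x+y}{1+x+y}\Big)^k$$ has, among pairs $x,y>0$ with $x\ne y$, exactly two solutions, $(x_1^*,x_2^*)$ and $(x_2^*,x_1^*)$, with $x_1^*<x_2^*$. The TISGMs $\mu_1^*$ and $\mu_2^*$ with boundary laws $(x_1^*,x_2^*)$ and $(x_2^*,x_1^*)$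 respectively exist, are uniquely determined and distinct, and both are extreme Gibbs measures. -/

import Mathlib

open scoped Classical in
/-- In a locally finite graph every ball is finite. -/
theorem WidomRowlinson.finite_ball {V : Type*} (G : SimpleGraph V) [G.LocallyFinite] (o : V)
    (n : ℕ) : {v : V | G.edist o v ≤ n}.Finite := by
  induction n with
  | zero =>
    refine (Set.finite_singleton o).subset fun v hv => ?_
    have h : G.edist o v ≤ ((0 : ℕ) : ℕ∞) := hv
    rw [Nat.cast_zero, nonpos_iff_eq_zero, SimpleGraph.edist_eq_zero_iff] at h
    exact h.symm
  | succ n ih =>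
    refine (ih.union (ih.biUnion fun w _ => (G.neighborFinset w).finite_toSet)).subset
      fun v hv => ?_
    have hv : G.edist o v ≤ ((n + 1 : ℕ) : ℕ∞) := hv
    obtain ⟨p, hp⟩ := SimpleGraph.exists_walk_of_edist_ne_top
      (ne_top_of_le_ne_top (ENat.natCast_ne_top _) hv)
    rw [← hp] at hv
    have hl : p.reverse.length ≤ n + 1 := by
      rw [SimpleGraph.Walk.length_reverse]
      exact_mod_cast hv
    generalize p.reverse = q at hl
    cases q with
    | nil => left; simp
    | @cons _ w _ h q =>
      right
      simp only [Set.mem_iUnion]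
      refine ⟨w, ?_, ?_⟩
      rotate_left
      · rw [Finset.mem_coe, SimpleGraph.mem_neighborFinset]
        exact h.symm
      · have hq : q.reverse.length ≤ n := by
          rw [SimpleGraph.Walk.length_reverse]
          simpa using hl
        exact (SimpleGraph.edist_le q.reverse).trans (by exact_mod_cast hq)

/-- The discrete σ-algebra on the spin space `{-1, 0, 1}`. -/
instance WidomRowlinson.instMeasurableSpaceSignType : MeasurableSpace SignType := ⊤

namespace WidomRowlinson

open MeasureTheory
open scoped NNReal Classical

noncomputable section

/-- `G` is the Cayley tree of order `k` with root `o`: a tree in which every vertex other than the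
root has degree `k + 1`, hence `k` direct successors.  The root has `k + 1` successors in the
homogeneous tree, and `k` successors in the tree in which each vertex has exactly `k` successors;
both trees are admitted. -/
def IsRootedCayleyTree {V : Type*} (G : SimpleGraph V) [G.LocallyFinite] (o : V) (k : ℕ) : Prop :=
  G.IsTree ∧ (∀ v, v ≠ o → G.degree v = k + 1) ∧ (G.degree o = k + 1 ∨ G.degree o = k)

/-- Spin configurations `ω : V → {-1, 0, 1}`, with the product σ-algebra. -/
abbrev Config (V : Type*) : Type _ := V → SignType

/-- The vertices at distance at most `n` from `o`. -/
def ball {V : Type*} (G : SimpleGraph V) [G.LocallyFinite] (o : V) (n : ℕ) : Finset V :=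
  (finite_ball G o n).toFinset

/-- The vertices at distance exactly `n` from `o`. -/
def sphere {V : Type*} (G : SimpleGraph V) [G.LocallyFinite] (o : V) (n : ℕ) : Finset V :=
  {v ∈ ball G o n | G.edist o v = n}

/-- The configuration equal to `τ` on `Λ` and to `ω` off `Λ`. -/
def glue {V : Type*} (Λ : Finset V) (τ : Λ → SignType) (ω : Config V) : Config V :=
  fun v => if h : v ∈ Λ then τ ⟨v, h⟩ else ω v

/-- The Widom-Rowlinson energy
`J ∑_{{i,j} ∈ E} 1(ω_i ω_j = -1) - (log lam / β) ∑_{i ∈ Λ} ω_i ^ 2`. -/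
def energy {V : Type*} (J β lam : ℝ) (E : Finset (Sym2 V)) (Λ : Finset V) (ω : Config V) : ℝ :=
  J * ∑ e ∈ E, (if (e.map ω).mul = -1 then 1 else 0) -
    Real.log lam / β * ∑ i ∈ Λ, ((ω i : SignType) : ℝ) ^ 2

/-- The edges with both endpoints in `Λ`. -/
def innerEdges {V : Type*} (G : SimpleGraph V) (Λ : Finset V) : Finset (Sym2 V) :=
  {e ∈ Λ.sym2 | e ∈ G.edgeSet}

/-- The edges with at least one endpoint in `Λ`. -/
def touchingEdges {V : Type*} (G : SimpleGraph V) [G.LocallyFinite] (Λ : Finset V) :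
    Finset (Sym2 V) :=
  Λ.biUnion fun i => G.incidenceFinset i

/-! ### Gibbs measures (Dobrushin-Lanford-Ruelle equations) -/

/-- The Boltzmann weight of `τ` in the volume `Λ` with boundary condition `ω`. -/
def gibbsWeight {V : Type*} (G : SimpleGraph V) [G.LocallyFinite] (J β lam : ℝ) (Λ : Finset V)
    (ω : Config V) (τ : Λ → SignType) : ℝ :=
  Real.exp (-β * energy J β lam (touchingEdges G Λ) Λ (glue Λ τ ω))

/-- The probability of the event `A` under the finite-volume Gibbs distribution in `Λ` with
boundary condition `ω`. -/
def gibbsSpec {V : Type*} (G : SimpleGraph V) [G.LocallyFinite] (J β lam : ℝ) (Λ : Finset V)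
    (ω : Config V) (A : Set (Config V)) : ℝ :=
  (∑ τ : Λ → SignType, if glue Λ τ ω ∈ A then gibbsWeight G J β lam Λ ω τ else 0) /
    ∑ τ : Λ → SignType, gibbsWeight G J β lam Λ ω τ

/-- `μ` is a Gibbs measure of the Widom-Rowlinson model on `G`: a probability measure with
`μ(A) = ∫ γ_Λ(A | ω) μ(dω)` for every finite `Λ` and every event `A`. -/
def IsGibbs {V : Type*} (G : SimpleGraph V) [G.LocallyFinite] (J β lam : ℝ)
    (μ : Measure (Config V)) : Prop :=
  IsProbabilityMeasure μ ∧
    ∀ (Λ : Finset V) (A : Set (Config V)), MeasurableSet A →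
      μ A = ∫⁻ ω, ENNReal.ofReal (gibbsSpec G J β lam Λ ω A) ∂μ

/-- `μ` is an extreme Gibbs measure: an extreme point of the convex set of Gibbs measures. -/
def IsExtremeGibbs {V : Type*} (G : SimpleGraph V) [G.LocallyFinite] (J β lam : ℝ)
    (μ : Measure (Config V)) : Prop :=
  μ ∈ Set.extremePoints ℝ≥0 {ν : Measure (Config V) | IsGibbs G J β lam ν}

/-! ### Splitting Gibbs measures -/

/-- The unnormalised weight `exp(-β H_n(ω) + ∑_{i ∈ W_n} h_{ω_i, i})`. -/
def splittingWeight {V : Type*} (G : SimpleGraph V) [G.LocallyFinite] (o : V) (J β lam : ℝ)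
    (h : V → SignType → ℝ) (n : ℕ) (ω : Config V) : ℝ :=
  Real.exp (-β * energy J β lam (innerEdges G (ball G o n)) (ball G o n) ω +
    ∑ i ∈ sphere G o n, h i (ω i))

/-- The finite-volume probability `μ_n(ω)` of the restriction of `ω` to `V_n`, with the fields `h`
on the boundary `W_n`.  (The configuration `0` used off `V_n` in the sum plays no role.) -/
def splittingProb {V : Type*} (G : SimpleGraph V) [G.LocallyFinite] (o : V) (J β lam : ℝ)
    (h : V → SignType → ℝ) (n : ℕ) (ω : Config V) : ℝ :=
  splittingWeight G o J β lam h n ω /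
    ∑ τ : ball G o n → SignType, splittingWeight G o J β lam h n (glue (ball G o n) τ 0)

/-- `μ` is the splitting Gibbs measure with fields `h`: the probability measure whose marginal on
each `V_n`, `n ≥ 1`, is `μ_n`.  (Such a `μ` can exist only if the `μ_n`, `n ≥ 1`, are
compatible.) -/
def IsSplittingGibbs {V : Type*} (G : SimpleGraph V) [G.LocallyFinite] (o : V) (J β lam : ℝ)
    (h : V → SignType → ℝ) (μ : Measure (Config V)) : Prop :=
  IsProbabilityMeasure μ ∧
    ∀ n : ℕ, 1 ≤ n → ∀ σ : Config V,
      μ {ω | ∀ i ∈ ball G o n, ω i = σ i} = ENNReal.ofReal (splittingProb G o J β lam h n σ)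

/-- `μ` is the translation-invariant splitting Gibbs measure with boundary law `(x, y)`: the fields
`h^i = h` do not depend on the vertex, and `x = lam e^{h_1 - h_0}`, `y = lam e^{h_{-1} - h_0}`. -/
def IsTISGM {V : Type*} (G : SimpleGraph V) [G.LocallyFinite] (o : V) (J β lam x y : ℝ)
    (μ : Measure (Config V)) : Prop :=
  ∃ h : SignType → ℝ, x = lam * Real.exp (h 1 - h 0) ∧ y = lam * Real.exp (h (-1) - h 0) ∧
    IsSplittingGibbs G o J β lam (fun _ => h) μ

/-- `(x, y)`, with positive entries, solves
`x = lam ((1 + x + θ y) / (1 + x + y))^k`, `y = lam ((1 + θ x + y) / (1 + x + y))^k`. -/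
def IsBoundaryLaw (k : ℕ) (θ lam x y : ℝ) : Prop :=
  0 < x ∧ 0 < y ∧
    x = lam * ((1 + x + θ * y) / (1 + x + y)) ^ k ∧
    y = lam * ((1 + θ * x + y) / (1 + x + y)) ^ k

/-- `θ_c(k) = (k - 1) / (k + 1)`. -/
def thetaCr (k : ℕ) : ℝ := ((k : ℝ) - 1) / ((k : ℝ) + 1)

/-- `λ_cr(k, θ) = ((k + 1) / k)^k / (k - 1 - θ (k + 1))`. -/
def lambdaCr (k : ℕ) (θ : ℝ) : ℝ :=
  1 / ((k : ℝ) - 1 - θ * ((k : ℝ) + 1)) * (((k : ℝ) + 1) / (k : ℝ)) ^ k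

end

end WidomRowlinson

namespace WidomRowlinson

open Filter Topology MeasureTheory
open scoped Classical ENNReal NNReal

noncomputable section

/-! ### The boundary law equations -/

/-! Extremality comes from stochastic order. For the order -1 < 0 < 1 on spins the interaction is
submodular, so by Holley's inequality the finite-volume Gibbs distributions increase with the
boundary condition (`gibbsSpec_mono`), and the all-plus boundary condition dominates every other. On
a tree that boundary condition is itself a boundary law, `(lam, lam * θ ^ k)`
(`gibbsSpec_ball_one`), and summing out one layer of spins applies `lawStep` to the law
(`lawMean_succ`). The iterates of `lawStep` from there are monotone, decreasing in the first entry
and increasing in the second, and they stay beyond the fixed point `(x₂, x₁)`. Their limit is a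
fixed point with unequal entries, so it can only be `(x₂, x₁)` (`tendsto_iterate_lawStep`). Thus
`μ₂` gives every increasing cylinder event the largest probability among all Gibbs measures, and by
the spin flip `μ₁` gives the smallest. These events determine a measure, so neither can be a proper
mixture (`isExtremeGibbs_of_upperCylinder`).

The argument needs exactly one asymmetric solution up to the flip. In terms of the `k`-th roots `a`,
`b`, `c` of `x`, `y`, `lam`, cancelling `a - b` leaves equations in the sum `S` and the product of
`a`, `b`: the product is a function of `S`, and `S` solves one equation. Distinct roots `a`, `b`
require a lower bound on `S`, and `lam` above its critical value guarantees it.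

Existence of the measures is Kolmogorov extension. The marginals are compatible because a boundary
law is fixed by `lawStep`. -/

/-- The pair `a < b` with given sum and product. -/
theorem exists_lt_of_sum_prod {S P : ℝ} (hS : 0 < S) (hP : 0 < P) (h : 4 * P < S ^ 2) :
    ∃ a b : ℝ, 0 < a ∧ a < b ∧ a + b = S ∧ a * b = P := by
  have hd : 0 < S ^ 2 - 4 * P := by linarith
  have hs := Real.sq_sqrt hd.le
  have hp := Real.sqrt_pos.2 hd
  refine ⟨(S - √(S ^ 2 - 4 * P)) / 2, (S + √(S ^ 2 - 4 * P)) / 2, ?_, by linarith, by ring, ?_⟩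
  · have : √(S ^ 2 - 4 * P) < S := (Real.sqrt_lt' hS).2 (by linarith)
    linarith
  · linear_combination (-1 / 4) * hs

theorem eq_of_sum_prod {a b a' b' : ℝ} (h : a < b) (h' : a' < b') (hS : a + b = a' + b')
    (hP : a * b = a' * b') : a = a' ∧ b = b' := by
  have h1 : (a - a') * (a - b') = 0 := by
    linear_combination a * hS - hP
  rcases mul_eq_zero.1 h1 with h1 | h1
  · constructor <;> linarith
  · linarith

/-- The boundary law equations for the `k`-th roots `a`, `b` of `x`, `y`. -/
def RootSystem (k : ℕ) (θ c a b : ℝ) : Prop :=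
  a * (1 + a ^ k + b ^ k) = c * (1 + a ^ k + θ * b ^ k) ∧
    b * (1 + a ^ k + b ^ k) = c * (1 + θ * a ^ k + b ^ k)

theorem RootSystem.symm {k : ℕ} {θ c a b : ℝ} (h : RootSystem k θ c a b) :
    RootSystem k θ c b a := by
  constructor
  · linear_combination h.2
  · linear_combination h.1

theorem RootSystem.isBoundaryLaw {k : ℕ} {θ c a b : ℝ} (ha : 0 < a) (hb : 0 < b)
    (h : RootSystem k θ c a b) : IsBoundaryLaw k θ (c ^ k) (a ^ k) (b ^ k) := by
  have hD : 0 < 1 + a ^ k + b ^ k := by positivity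
  refine ⟨by positivity, by positivity, ?_, ?_⟩
  · rw [← mul_pow]
    congr 1
    rw [← mul_div_assoc, eq_div_iff hD.ne', h.1]
  · rw [← mul_pow]
    congr 1
    rw [← mul_div_assoc, eq_div_iff hD.ne', h.2]

theorem IsBoundaryLaw.exists_rootSystem {k : ℕ} {θ c x y : ℝ} (hθ : 0 < θ) (hc : 0 < c)
    (h : IsBoundaryLaw k θ (c ^ k) x y) :
    ∃ a b : ℝ, 0 < a ∧ 0 < b ∧ x = a ^ k ∧ y = b ^ k ∧ RootSystem k θ c a b := by
  obtain ⟨hx, hy, h1, h2⟩ := h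
  have hD : 0 < 1 + x + y := by positivity
  rw [← mul_pow] at h1 h2
  refine ⟨_, _, ?_, ?_, h1, h2, ?_⟩
  · positivity
  · positivity
  · unfold RootSystem
    rw [← h1, ← h2]
    constructor <;> field_simp

/-- Cross-multiplying the two equations eliminates the common denominator, and subtracting them
gives a second relation. Both are divisible by `a - b`, and the quotients are symmetric in `a` and
`b`. -/
theorem rootSystem_two_iff {θ c a b : ℝ} (hθ : 0 < θ) (hθ1 : θ < 1) (hc : 0 < c) (h : a ≠ b) :
    RootSystem 2 θ c a b ↔
      (1 + θ) * (a * b) = 1 + θ * (a + b) ^ 2 ∧ (a + b) ^ 2 - 1 = c * (1 + θ) * (a + b) := by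
  have hab : a - b ≠ 0 := sub_ne_zero.2 h
  have h1 : 1 - θ ≠ 0 := by linarith
  have h2 : 1 + θ ≠ 0 := by linarith
  constructor
  · rintro ⟨ha, hb⟩
    have e1 : (1 + θ) * (a * b) = 1 + θ * (a + b) ^ 2 := by
      refine mul_left_cancel₀ (mul_ne_zero hc.ne' hab) ?_
      linear_combination a * hb - b * ha
    have e2 : 1 + a ^ 2 + b ^ 2 = c * (1 - θ) * (a + b) := by
      refine mul_left_cancel₀ hab ?_
      linear_combination ha - hb
    refine ⟨e1, mul_left_cancel₀ h1 ?_⟩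
    linear_combination (1 + θ) * e2 + 2 * e1
  · rintro ⟨e1, e2⟩
    have e3 : 1 + a ^ 2 + b ^ 2 = c * (1 - θ) * (a + b) := by
      refine mul_left_cancel₀ h2 ?_
      linear_combination (1 - θ) * e2 - 2 * e1
    constructor
    · linear_combination a * e3 + c * e1
    · linear_combination b * e3 + c * e1

theorem rootSystem_three_iff {θ c a b : ℝ} (hθ : 0 < θ) (hθ1 : θ < 1) (hc : 0 < c) (h : a ≠ b)
    (hS : 0 < a + b) :
    RootSystem 3 θ c a b ↔
      (1 + 2 * θ) * (a * b * (a + b)) = 1 + θ * (a + b) ^ 3 ∧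
        (a + b) * ((a + b) ^ 3 - 2) = c * ((1 + θ) * (a + b) ^ 3 - 1) := by
  have hab : a - b ≠ 0 := sub_ne_zero.2 h
  have h1 : 1 - θ ≠ 0 := by linarith
  have h2 : 1 + 2 * θ ≠ 0 := by linarith
  constructor
  · rintro ⟨ha, hb⟩
    have e1 : (1 + 2 * θ) * (a * b * (a + b)) = 1 + θ * (a + b) ^ 3 := by
      refine mul_left_cancel₀ (mul_ne_zero hc.ne' hab) ?_
      linear_combination a * hb - b * ha
    have e2 : 1 + a ^ 3 + b ^ 3 = c * (1 - θ) * ((a + b) ^ 2 - a * b) := by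
      refine mul_left_cancel₀ hab ?_
      linear_combination ha - hb
    refine ⟨e1, mul_left_cancel₀ h1 ?_⟩
    linear_combination (1 + 2 * θ) * (a + b) * e2 + (3 * (a + b) - c * (1 - θ)) * e1
  · rintro ⟨e1, e2⟩
    have e3 : 1 + a ^ 3 + b ^ 3 = c * (1 - θ) * ((a + b) ^ 2 - a * b) := by
      refine mul_left_cancel₀ (mul_ne_zero h2 hS.ne') ?_
      linear_combination (1 - θ) * e2 - (3 * (a + b) - c * (1 - θ)) * e1
    constructor
    · linear_combination a * e3 + c * e1
    · linear_combination b * e3 + c * e1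

theorem existsUnique_rootSystem_two {θ c : ℝ} (hθ : 0 < θ) (hθ1 : 0 < 1 - 3 * θ) (hc : 0 < c)
    (hlam : 9 < 4 * (1 - 3 * θ) * c ^ 2) :
    ∃ a b : ℝ, 0 < a ∧ a < b ∧ RootSystem 2 θ c a b ∧
      ∀ a' b' : ℝ, 0 < a' → a' < b' → RootSystem 2 θ c a' b' → a' = a ∧ b' = b := by
  set m := c * (1 + θ) with hm
  have hm0 : 0 < m := by positivity
  obtain ⟨S, hS, hSm, hS4⟩ : ∃ S : ℝ, 0 < S ∧ S ^ 2 - 1 = m * S ∧ 4 < (1 - 3 * θ) * S ^ 2 := by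
    have hq := Real.sq_sqrt (show (0 : ℝ) ≤ m ^ 2 + 4 by positivity)
    have hq0 := Real.sqrt_nonneg (m ^ 2 + 4)
    refine ⟨(m + √(m ^ 2 + 4)) / 2, by positivity, by linear_combination hq / 4, ?_⟩
    set S := (m + √(m ^ 2 + 4)) / 2
    have hS0 : 0 < S := by positivity
    have hSm : S ^ 2 - 1 = m * S := by linear_combination hq / 4
    -- The equation for `S` reads `c² = (u - 1)² / ((1 + θ)² u)` with `u = S²`, which increases for
    -- `u > 1`. At `u = 4 / (1 - 3θ)`, where `a = b`, its value is `9 / (4(1 - 3θ))`, so `hle`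
    -- contradicts `hlam`.
    by_contra! hle
    have hcS : (S ^ 2 - 1) ^ 2 = c ^ 2 * (1 + θ) ^ 2 * S ^ 2 := by
      rw [hSm, hm]; ring
    have hS1 : 1 < S ^ 2 := by nlinarith [mul_pos hm0 hS0]
    have h1 : 9 * (1 + θ) ^ 2 * S ^ 2 < 4 * (1 - 3 * θ) * (S ^ 2 - 1) ^ 2 := by
      rw [hcS]
      have : 0 < (1 + θ) ^ 2 * S ^ 2 := by positivity
      nlinarith
    set u := S ^ 2
    have h2 : (1 - 3 * θ) * (u - 1) ≤ 3 * (1 + θ) := by linarith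
    have h3 : 4 * (1 - 3 * θ) * (u - 1) ^ 2 ≤ 12 * (1 + θ) * (u - 1) := by
      nlinarith [mul_le_mul_of_nonneg_right h2 (show 0 ≤ u - 1 by linarith)]
    have h4 : 3 * (1 + θ) * u < 4 * (u - 1) := by
      by_contra! h4
      nlinarith
    nlinarith
  have hP : 4 * ((1 + θ * S ^ 2) / (1 + θ)) < S ^ 2 := by
    rw [← mul_div_assoc, div_lt_iff₀ (by linarith)]
    linarith
  obtain ⟨a, b, ha, hab, rfl, hPab⟩ := exists_lt_of_sum_prod hS (by positivity) hP
  rw [eq_div_iff (by linarith)] at hPab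
  refine ⟨a, b, ha, hab, (rootSystem_two_iff hθ (by linarith) hc hab.ne).2 ⟨by linarith, hSm⟩, ?_⟩
  intro a' b' ha' hab' h
  obtain ⟨e1, e2⟩ := (rootSystem_two_iff hθ (by linarith) hc hab'.ne).1 h
  have hS' : a' + b' = a + b := by
    have h0 : (a' + b' - (a + b)) * ((a' + b') * (a + b) + 1) = 0 := by
      linear_combination (a + b) * e2 - (a' + b') * hSm
    rcases mul_eq_zero.1 h0 with h0 | h0
    · linarith
    · have : 0 < (a' + b') * (a + b) := mul_pos (by linarith) hS
      linarith
  refine eq_of_sum_prod hab' hab hS' (mul_left_cancel₀ (show 1 + θ ≠ 0 by linarith) ?_)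
  rw [e1, hS']
  linarith

theorem existsUnique_rootSystem_three {θ c : ℝ} (hθ : 0 < θ) (hθ1 : 0 < 1 - 2 * θ) (hc : 0 < c)
    (hlam : 32 < 27 * (1 - 2 * θ) * c ^ 3) :
    ∃ a b : ℝ, 0 < a ∧ a < b ∧ RootSystem 3 θ c a b ∧
      ∀ a' b' : ℝ, 0 < a' → a' < b' → RootSystem 3 θ c a' b' → a' = a ∧ b' = b := by
  -- This is the discriminant condition `4ab < (a + b)²` after eliminating `ab`. It confines every
  -- asymmetric solution to the range of `S` where the equation for `S` has only one root.
  have hlower : ∀ a b : ℝ, 0 < a → a < b →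
      (1 + 2 * θ) * (a * b * (a + b)) = 1 + θ * (a + b) ^ 3 →
      4 < (1 - 2 * θ) * (a + b) ^ 3 := by
    intro a b ha hab h
    have : 0 < (1 + 2 * θ) * ((a + b) * (a - b) ^ 2) := by
      have := sq_pos_of_neg (sub_neg.2 hab)
      have hb := ha.trans hab
      positivity
    linear_combination this - 4 * h
  obtain ⟨S, hS, hSc, hS4⟩ : ∃ S : ℝ, 0 < S ∧ S * (S ^ 3 - 2) = c * ((1 + θ) * S ^ 3 - 1) ∧
      4 < (1 - 2 * θ) * S ^ 3 := by
    set g : ℝ → ℝ := fun S => S * (S ^ 3 - 2) - c * ((1 + θ) * S ^ 3 - 1)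
    have hg : Continuous g := by fun_prop
    -- The value of `S` at which `a = b`. There `g` has the sign of `2r - 3c`, and `hlam` says
    -- exactly that this is negative.
    set r : ℝ := (4 / (1 - 2 * θ)) ^ (1 / 3 : ℝ)
    have hr : 0 < r := by positivity
    have hr3 : r ^ 3 = 4 / (1 - 2 * θ) := by
      rw [← Real.rpow_natCast, ← Real.rpow_mul (by positivity)]
      norm_num
    have hr3' : (1 - 2 * θ) * r ^ 3 = 4 := by
      rw [hr3]; field_simp
    have hrc : 2 * r < 3 * c := by
      refine lt_of_pow_lt_pow_left₀ 3 (by positivity) ?_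
      nlinarith
    have hgr : g r < 0 := by
      have h1 : (1 - 2 * θ) * g r = (1 + 2 * θ) * (2 * r - 3 * c) := by
        simp only [g]
        linear_combination (r - c * (1 + θ)) * hr3'
      have h2 : (1 + 2 * θ) * (2 * r - 3 * c) < 0 := by nlinarith
      rw [← h1] at h2
      exact (pos_iff_neg_of_mul_neg h2).1 hθ1
    have hgR : 0 < g (2 * c + 2) := by
      have h1 : g (2 * c + 2) =
          (2 * c + 2) ^ 3 * (2 + c * (1 - θ)) - 2 * (2 * c + 2) + c := by
        simp only [g]; ring
      have h2 : 0 < c * (1 - θ) := mul_pos hc (by linarith)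
      have h3 : (2 * c + 2) ^ 3 * 2 ≤ (2 * c + 2) ^ 3 * (2 + c * (1 - θ)) := by gcongr; linarith
      rw [h1]
      nlinarith [pow_pos hc 3, pow_pos hc 2]
    obtain ⟨S, hSI, hSg⟩ := intermediate_value_Ioo (show r ≤ 2 * c + 2 by linarith)
      hg.continuousOn ⟨hgr, hgR⟩
    refine ⟨S, hr.trans hSI.1, by simpa [g, sub_eq_zero] using hSg, ?_⟩
    rw [← hr3']
    have := hSI.1
    gcongr
  have hP : 4 * ((1 + θ * S ^ 3) / ((1 + 2 * θ) * S)) < S ^ 2 := by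
    rw [← mul_div_assoc, div_lt_iff₀ (by positivity)]
    linarith
  obtain ⟨a, b, ha, hab, rfl, hPab⟩ := exists_lt_of_sum_prod hS (by positivity) hP
  rw [eq_div_iff (by positivity)] at hPab
  refine ⟨a, b, ha, hab, (rootSystem_three_iff hθ (by linarith) hc hab.ne hS).2
    ⟨by linarith, hSc⟩, ?_⟩
  intro a' b' ha' hab' h
  have hS'0 : 0 < a' + b' := by linarith
  obtain ⟨e1, e2⟩ := (rootSystem_three_iff hθ (by linarith) hc hab'.ne hS'0).1 h
  have hS' : a' + b' = a + b := by
    have h4 := hlower a' b' ha' hab' e1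
    set T := a' + b'
    set S := a + b
    have hS3 : 4 < S ^ 3 := by nlinarith [pow_pos hS 3]
    have hT3 : 4 < T ^ 3 := by nlinarith [pow_pos hS'0 3]
    -- Eliminating `c` between the equations for `T` and `S` leaves a factor `T - S`. The cofactor
    -- is positive because both cubes exceed 4.
    have h0 : (T - S) * ((1 + θ) * (T ^ 3 * S ^ 3) +
        (2 * (1 + θ) * (T * S * (T + S))) - (T + S) * (T ^ 2 + S ^ 2) + 2) = 0 := by
      have hc0 : c * ((T - S) * ((1 + θ) * (T ^ 3 * S ^ 3) +
        (2 * (1 + θ) * (T * S * (T + S))) - (T + S) * (T ^ 2 + S ^ 2) + 2)) = 0 := by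
        linear_combination c * ((1 + θ) * S ^ 3 - 1) * e2 - c * ((1 + θ) * T ^ 3 - 1) * hSc
      exact (mul_eq_zero.1 hc0).resolve_left hc.ne'
    have hpos : 0 < (1 + θ) * (T ^ 3 * S ^ 3) +
        (2 * (1 + θ) * (T * S * (T + S))) - (T + S) * (T ^ 2 + S ^ 2) + 2 := by
      have h5 : 0 ≤ θ * (T ^ 3 * S ^ 3) := by positivity
      have h6 : 0 ≤ (1 + 2 * θ) * (T * S * (T + S)) := by positivity
      have h7 : 0 < (T ^ 3 - 4) * (S ^ 3 - 4) := mul_pos (by linarith) (by linarith)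
      linarith
    rcases mul_eq_zero.1 h0 with h0 | h0
    · linarith
    · exact absurd h0 hpos.ne'
  refine eq_of_sum_prod hab' hab hS' (mul_left_cancel₀
    (show (1 + 2 * θ) * (a + b) ≠ 0 by positivity) ?_)
  rw [hS'] at e1
  linarith

theorem existsUnique_rootSystem {k : ℕ} (hk : k = 2 ∨ k = 3) {θ lam : ℝ} (hθ : 0 < θ)
    (hθ1 : θ < thetaCr k) (hlam : lambdaCr k θ < lam) :
    ∃ c : ℝ, 0 < c ∧ c ^ k = lam ∧
      ∃ a b : ℝ, 0 < a ∧ a < b ∧ RootSystem k θ c a b ∧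
        ∀ a' b' : ℝ, 0 < a' → a' < b' → RootSystem k θ c a' b' → a' = a ∧ b' = b := by
  have hk0 : (k : ℝ) ≠ 0 := by rcases hk with rfl | rfl <;> norm_num
  unfold thetaCr at hθ1
  have hd : 0 < (k : ℝ) - 1 - θ * (k + 1) := by
    rw [lt_div_iff₀ (by positivity)] at hθ1
    linarith
  have hlam0 : 0 < lam := lt_trans (by unfold lambdaCr; positivity) hlam
  unfold lambdaCr at hlam
  rw [div_mul_eq_mul_div, one_mul, div_lt_iff₀ hd] at hlam
  have hc : (lam ^ (1 / k : ℝ)) ^ k = lam := by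
    rw [← Real.rpow_natCast, ← Real.rpow_mul hlam0.le, one_div_mul_cancel hk0, Real.rpow_one]
  refine ⟨lam ^ (1 / k : ℝ), by positivity, hc, ?_⟩
  rw [← hc] at hlam
  generalize hc' : lam ^ (1 / k : ℝ) = c at hlam
  have hc0 : 0 < c := hc' ▸ by positivity
  rcases hk with rfl | rfl
  · norm_num at hlam hd
    exact existsUnique_rootSystem_two hθ (by linarith) hc0 (by linarith)
  · norm_num at hlam hd
    exact existsUnique_rootSystem_three hθ (by linarith) hc0 (by linarith)

/-- Exactly two asymmetric boundary laws, exchanged by the spin flip. -/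
theorem exists_asymmetric_boundaryLaw {k : ℕ} (hk : k = 2 ∨ k = 3) {θ lam : ℝ} (hθ : 0 < θ)
    (hθ1 : θ < thetaCr k) (hlam : lambdaCr k θ < lam) :
    ∃ x₁ x₂ : ℝ, x₁ < x₂ ∧ ∀ x y : ℝ, (IsBoundaryLaw k θ lam x y ∧ x ≠ y) ↔
      (x = x₁ ∧ y = x₂) ∨ (x = x₂ ∧ y = x₁) := by
  obtain ⟨c, hc, rfl, a, b, ha, hab, h, huniq⟩ := existsUnique_rootSystem hk hθ hθ1 hlam
  have hk0 : k ≠ 0 := by rcases hk with rfl | rfl <;> norm_num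
  have hlt : a ^ k < b ^ k := pow_lt_pow_left₀ hab ha.le hk0
  refine ⟨a ^ k, b ^ k, hlt, fun x y => ⟨?_, ?_⟩⟩
  · rintro ⟨hxy, hne⟩
    obtain ⟨a', b', ha', hb', rfl, rfl, h'⟩ := hxy.exists_rootSystem hθ hc
    rcases lt_trichotomy a' b' with hlt | rfl | hlt
    · obtain ⟨rfl, rfl⟩ := huniq _ _ ha' hlt h'
      exact Or.inl ⟨rfl, rfl⟩
    · exact absurd rfl hne
    · obtain ⟨rfl, rfl⟩ := huniq _ _ hb' hlt h'.symm
      exact Or.inr ⟨rfl, rfl⟩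
  · rintro (⟨rfl, rfl⟩ | ⟨rfl, rfl⟩)
    · exact ⟨h.isBoundaryLaw ha (ha.trans hab), hlt.ne⟩
    · exact ⟨h.symm.isBoundaryLaw (ha.trans hab) ha, hlt.ne'⟩

/-! ### The recursion for boundary laws -/

/-- One step of the recursion for boundary laws. -/
def lawStep (k : ℕ) (θ lam : ℝ) (p : ℝ × ℝ) : ℝ × ℝ :=
  (lam * ((1 + p.1 + θ * p.2) / (1 + p.1 + p.2)) ^ k,
    lam * ((1 + θ * p.1 + p.2) / (1 + p.1 + p.2)) ^ k)

theorem lawStep_swap (k : ℕ) (θ lam : ℝ) (p : ℝ × ℝ) :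
    lawStep k θ lam p.swap = (lawStep k θ lam p).swap := by
  simp only [lawStep, Prod.fst_swap, Prod.snd_swap, Prod.swap_prod_mk]
  congr 4 <;> ring

theorem isBoundaryLaw_iff {k : ℕ} {θ lam x y : ℝ} :
    IsBoundaryLaw k θ lam x y ↔ 0 < x ∧ 0 < y ∧ lawStep k θ lam (x, y) = (x, y) := by
  simp only [IsBoundaryLaw, lawStep, Prod.mk.injEq]
  grind

theorem lawStep_pos {k : ℕ} {θ lam : ℝ} (hθ : 0 < θ) (hlam : 0 < lam) {p : ℝ × ℝ}
    (hp : 0 < p.1 ∧ 0 < p.2) : 0 < (lawStep k θ lam p).1 ∧ 0 < (lawStep k θ lam p).2 := by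
  obtain ⟨h1, h2⟩ := hp
  constructor <;> simp only [lawStep] <;> positivity

theorem iterate_lawStep_pos {k : ℕ} {θ lam : ℝ} (hθ : 0 < θ) (hlam : 0 < lam) {p : ℝ × ℝ}
    (hp : 0 < p.1 ∧ 0 < p.2) (j : ℕ) :
    0 < ((lawStep k θ lam)^[j] p).1 ∧ 0 < ((lawStep k θ lam)^[j] p).2 := by
  induction j with
  | zero => exact hp
  | succ j ih => rw [Function.iterate_succ_apply']; exact lawStep_pos hθ hlam ih

/-- The first fraction is `1 - (1 - θ) p.2 / (1 + p.1 + p.2)`, which increases in `p.1` and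
decreases in `p.2`; the other is its mirror image. Hence `lawStep` respects the order in which a law
grows when it favours plus. -/
theorem lawStep_mono {k : ℕ} {θ lam : ℝ} (hθ : 0 < θ) (hθ1 : θ < 1) (hlam : 0 < lam) {p q : ℝ × ℝ}
    (hp : 0 < p.1 ∧ 0 < p.2) (hq : 0 < q.1 ∧ 0 < q.2) (h1 : p.1 ≤ q.1) (h2 : q.2 ≤ p.2) :
    (lawStep k θ lam p).1 ≤ (lawStep k θ lam q).1 ∧
      (lawStep k θ lam q).2 ≤ (lawStep k θ lam p).2 := by
  obtain ⟨p1, p2⟩ := p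
  obtain ⟨q1, q2⟩ := q
  obtain ⟨hp1, hp2⟩ := hp
  obtain ⟨hq1, hq2⟩ := hq
  simp only at *
  have h3 : p1 * q2 ≤ q1 * p2 := mul_le_mul h1 h2 hq2.le hq1.le
  have hθ' : 0 ≤ 1 - θ := by linarith
  constructor <;> simp only [lawStep] <;> gcongr ?_ * ?_ ^ k <;>
    rw [div_le_div_iff₀ (by positivity) (by positivity)]
  · nlinarith [mul_nonneg hθ' (show 0 ≤ p2 - q2 + (q1 * p2 - p1 * q2) by linarith)]
  · nlinarith [mul_nonneg hθ' (show 0 ≤ q1 - p1 + (q1 * p2 - p1 * q2) by linarith)]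

/-- Both fractions lie between `θ` and 1. So the all-plus law `(lam, lam * θ ^ k)` lies above every
image of `lawStep`, in particular above every positive fixed point and its own image. -/
theorem lawStep_le {k : ℕ} {θ lam : ℝ} (hθ : 0 < θ) (hθ1 : θ < 1) (hlam : 0 < lam) {p : ℝ × ℝ}
    (hp : 0 < p.1 ∧ 0 < p.2) :
    (lawStep k θ lam p).1 ≤ lam ∧ lam * θ ^ k ≤ (lawStep k θ lam p).2 := by
  obtain ⟨p1, p2⟩ := p
  obtain ⟨hp1, hp2⟩ := hp
  simp only at *
  constructor <;> simp only [lawStep]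
  · refine mul_le_of_le_one_right hlam.le (pow_le_one₀ (by positivity) ?_)
    rw [div_le_one (by positivity)]
    nlinarith
  · gcongr
    rw [le_div_iff₀ (by positivity)]
    nlinarith

theorem continuousAt_lawStep {k : ℕ} {θ lam : ℝ} {p : ℝ × ℝ} (hp : 0 < p.1 ∧ 0 < p.2) :
    ContinuousAt (lawStep k θ lam) p := by
  have : 1 + p.1 + p.2 ≠ 0 := by linarith [hp.1, hp.2]
  unfold lawStep
  fun_prop (disch := assumption)

/-- The iteration started at the law of the all-plus boundary condition converges to the
asymmetric boundary law with the larger first entry. -/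
theorem tendsto_iterate_lawStep {k : ℕ} {θ lam x₁ x₂ : ℝ} (hθ : 0 < θ) (hθ1 : θ < 1)
    (hlam : 0 < lam) (hlt : x₁ < x₂)
    (H : ∀ x y : ℝ, (IsBoundaryLaw k θ lam x y ∧ x ≠ y) ↔
      (x = x₁ ∧ y = x₂) ∨ (x = x₂ ∧ y = x₁)) :
    Tendsto (fun j => (lawStep k θ lam)^[j] (lam, lam * θ ^ k)) atTop (𝓝 (x₂, x₁)) := by
  set F := lawStep k θ lam
  set u : ℕ → ℝ × ℝ := fun j => F^[j] (lam, lam * θ ^ k)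
  obtain ⟨hx₂, hx₁, hfix⟩ := isBoundaryLaw_iff.1 ((H x₂ x₁).2 (Or.inr ⟨rfl, rfl⟩)).1
  have hu0 : 0 < (u 0).1 ∧ 0 < (u 0).2 := ⟨hlam, by
    simp only [u, Function.iterate_zero, id]; positivity⟩
  have hpos : ∀ j, 0 < (u j).1 ∧ 0 < (u j).2 := iterate_lawStep_pos hθ hlam hu0
  have hsucc : ∀ j, u (j + 1) = F (u j) := fun j => Function.iterate_succ_apply' _ _ _
  have hbd : ∀ j, x₂ ≤ (u j).1 ∧ (u j).2 ≤ x₁ := by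
    intro j
    induction j with
    | zero =>
      have := lawStep_le (k := k) hθ hθ1 hlam (p := (x₂, x₁)) ⟨hx₂, hx₁⟩
      rwa [hfix] at this
    | succ j ih =>
      have := lawStep_mono (k := k) hθ hθ1 hlam (p := (x₂, x₁)) (q := u j) ⟨hx₂, hx₁⟩ (hpos j)
        ih.1 ih.2
      rw [hfix] at this
      rw [hsucc]
      exact this
  have hstep : ∀ j, (u (j + 1)).1 ≤ (u j).1 ∧ (u j).2 ≤ (u (j + 1)).2 := by
    intro j
    induction j with
    | zero => rw [hsucc]; exact lawStep_le hθ hθ1 hlam hu0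
    | succ j ih =>
      have := lawStep_mono (k := k) hθ hθ1 hlam (hpos (j + 1)) (hpos j) ih.1 ih.2
      rw [hsucc (j + 1)]
      exact ⟨this.1.trans_eq (congrArg Prod.fst (hsucc j)).symm,
        (congrArg Prod.snd (hsucc j)).trans_le this.2⟩
  have hanti : Antitone fun j => (u j).1 := antitone_nat_of_succ_le fun j => (hstep j).1
  have hmono : Monotone fun j => (u j).2 := monotone_nat_of_le_succ fun j => (hstep j).2
  obtain ⟨x, hx⟩ : ∃ x, Tendsto (fun j => (u j).1) atTop (𝓝 x) :=
    ⟨_, tendsto_atTop_ciInf hanti ⟨x₂, by rintro _ ⟨j, rfl⟩; exact (hbd j).1⟩⟩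
  obtain ⟨y, hy⟩ : ∃ y, Tendsto (fun j => (u j).2) atTop (𝓝 y) :=
    ⟨_, tendsto_atTop_ciSup hmono ⟨x₁, by rintro _ ⟨j, rfl⟩; exact (hbd j).2⟩⟩
  have hx₂x : x₂ ≤ x := ge_of_tendsto' hx fun j => (hbd j).1
  have hyx₁ : y ≤ x₁ := le_of_tendsto' hy fun j => (hbd j).2
  have hy0 : 0 < y := hu0.2.trans_le (hmono.ge_of_tendsto hy 0)
  have hlim : Tendsto u atTop (𝓝 (x, y)) := hx.prodMk_nhds hy
  have hxy0 : 0 < x ∧ 0 < y := ⟨hx₂.trans_le hx₂x, hy0⟩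
  have hF : F (x, y) = (x, y) :=
    isFixedPt_of_tendsto_iterate hlim (continuousAt_lawStep hxy0)
  -- The bounds `y ≤ x₁ < x₂ ≤ x` survive in the limit, so the limit is not a symmetric law.
  rcases (H x y).1 ⟨isBoundaryLaw_iff.2 ⟨hxy0.1, hxy0.2, hF⟩, by linarith⟩ with h | h
  · linarith [h.1, h.2]
  · rwa [h.1, h.2] at hlim

theorem tendsto_iterate_lawStep_swap {k : ℕ} {θ lam : ℝ} {p q : ℝ × ℝ}
    (h : Tendsto (fun j => (lawStep k θ lam)^[j] p) atTop (𝓝 q)) :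
    Tendsto (fun j => (lawStep k θ lam)^[j] p.swap) atTop (𝓝 q.swap) := by
  have : (fun j => (lawStep k θ lam)^[j] p.swap) =
      Prod.swap ∘ fun j => (lawStep k θ lam)^[j] p := by
    funext j
    exact ((Function.Semiconj.iterate_right
      (fun p => (lawStep_swap k θ lam p).symm) j) p).symm
  rw [this]
  exact (continuous_swap.tendsto q).comp h

/-! ### Spin systems -/

/-- The Kolmogorov extension theorem for a finite spin space. -/
theorem exists_isProjectiveLimit_of_finite {ι S : Type*} [Finite S] [TopologicalSpace S]
    [DiscreteTopology S] [MeasurableSpace S] {P : ∀ I : Finset ι, Measure (I → S)}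
    [∀ I, IsFiniteMeasure (P I)] (hP : IsProjectiveMeasureFamily (α := fun _ => S) P) :
    ∃ μ : Measure (ι → S), IsProjectiveLimit (α := fun _ => S) μ P := by
  have hsub : (projectiveFamilyContent hP).IsSigmaSubadditive := by
    refine isSigmaSubadditive_of_addContent_iUnion_eq_tsum isSetRing_measurableCylinders
      (fun f hf hfU hdisj => addContent_iUnion_eq_sum_of_tendsto_zero isSetRing_measurableCylinders
        _ (fun s _ => projectiveFamilyContent_ne_top hP) (fun s hs hanti hinter => ?_)
        hf hfU hdisj)
    -- Cylinders are closed in a compact product, so a decreasing sequence of them with empty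
    -- intersection is eventually empty. Continuity of the content at the empty set is then
    -- automatic.
    have hclosed : ∀ n, IsClosed (s n) := by
      intro n
      obtain ⟨I, T, -, hT⟩ := (mem_measurableCylinders _).1 (hs n)
      rw [hT]
      exact (isClosed_discrete T).cylinder I
    obtain ⟨N, hN⟩ : ∃ N, s N = ∅ := by
      by_contra! hne
      have := IsCompact.nonempty_iInter_of_directed_nonempty_isCompact_isClosed s
        hanti.directed_ge hne (fun n => (hclosed n).isCompact) hclosed
      rw [hinter] at this
      exact Set.not_nonempty_empty this
    refine tendsto_const_nhds.congr' ?_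
    filter_upwards [eventually_ge_atTop N] with n hn
    rw [show s n = ∅ from Set.eq_empty_of_subset_empty (hN ▸ hanti hn), addContent_empty]
  refine ⟨(projectiveFamilyContent hP).measure isSetSemiring_measurableCylinders
    generateFrom_measurableCylinders.ge hsub, fun I => ?_⟩
  ext s hs
  rw [Measure.map_apply (by fun_prop) hs, AddContent.measure_eq, ← cylinder,
    projectiveFamilyContent_cylinder hP hs]
  · exact generateFrom_measurableCylinders.symm
  · exact cylinder_mem_measurableCylinders _ _ hs

instance : DiscreteMeasurableSpace SignType := ⟨fun _ => trivial⟩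

section Spins

variable {V : Type*}

/-! ### Summation over the spins in a finite set -/

theorem glue_of_mem {Λ : Finset V} (τ : Λ → SignType) (ω : Config V) {v : V} (h : v ∈ Λ) :
    glue Λ τ ω v = τ ⟨v, h⟩ := dif_pos h

theorem glue_of_notMem {Λ : Finset V} (τ : Λ → SignType) (ω : Config V) {v : V} (h : v ∉ Λ) :
    glue Λ τ ω v = ω v := dif_neg h

theorem glue_mono (Λ : Finset V) {τ τ' : Λ → SignType} {ω ω' : Config V} (h : τ ≤ τ')
    (h' : ω ≤ ω') : glue Λ τ ω ≤ glue Λ τ' ω' := by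
  intro v
  by_cases hv : v ∈ Λ
  · rw [glue_of_mem _ _ hv, glue_of_mem _ _ hv]; exact h _
  · rw [glue_of_notMem _ _ hv, glue_of_notMem _ _ hv]; exact h' _

/-- The sum of `f` over all configurations that agree with `ω` off `Λ`. -/
def cfgSum (Λ : Finset V) (f : Config V → ℝ) (ω : Config V) : ℝ :=
  ∑ τ : Λ → SignType, f (glue Λ τ ω)

theorem cfgSum_nonneg {Λ : Finset V} {f : Config V → ℝ} (h : ∀ ω, 0 ≤ f ω) (ω : Config V) :
    0 ≤ cfgSum Λ f ω := Finset.sum_nonneg fun _ _ => h _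

theorem cfgSum_pos {Λ : Finset V} {f : Config V → ℝ} (h : ∀ ω, 0 < f ω) (ω : Config V) :
    0 < cfgSum Λ f ω := Finset.sum_pos (fun _ _ => h _) Finset.univ_nonempty

theorem cfgSum_congr {Λ : Finset V} {f g : Config V → ℝ} {ω ω' : Config V}
    (h : ∀ τ : Λ → SignType, f (glue Λ τ ω) = g (glue Λ τ ω')) : cfgSum Λ f ω = cfgSum Λ g ω' :=
  Finset.sum_congr rfl fun τ _ => h τ

theorem cfgSum_union {Λ Δ : Finset V} (h : Disjoint Λ Δ) (f : Config V → ℝ) (ω : Config V) :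
    cfgSum (Λ ∪ Δ) f ω = cfgSum Λ (cfgSum Δ f) ω := by
  unfold cfgSum
  rw [← Fintype.sum_prod_type' (f := fun τ τ' => f (glue Δ τ' (glue Λ τ ω)))]
  refine (Fintype.sum_equiv (Equiv.piFinsetUnion (fun _ => SignType) h) _ _ fun p => ?_).symm
  exact congrArg f (Function.updateFinset_updateFinset (x := ω) (y := p.1) (z := p.2) h)

/-- A factor that does not depend on the spins in `Λ` can be pulled out. -/
theorem cfgSum_mul_left {Λ : Finset V} {f g : Config V → ℝ} {s : Set V} (hg : DependsOn g s)
    (hs : Disjoint s Λ) (ω : Config V) :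
    cfgSum Λ (fun ω => g ω * f ω) ω = g ω * cfgSum Λ f ω := by
  unfold cfgSum
  rw [Finset.mul_sum]
  refine Finset.sum_congr rfl fun τ _ => ?_
  refine congrArg (· * f (glue Λ τ ω)) ?_
  exact hg fun v hv => glue_of_notMem _ _ fun hv' => Set.disjoint_left.1 hs hv hv'

theorem cfgSum_const_mul {Λ : Finset V} (c : ℝ) (f : Config V → ℝ) (ω : Config V) :
    cfgSum Λ (fun ω => c * f ω) ω = c * cfgSum Λ f ω := (Finset.mul_sum _ _ _).symm

theorem cfgSum_prod (Λ : Finset V) (φ : V → SignType → ℝ) (ω : Config V) :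
    cfgSum Λ (fun ω => ∏ j ∈ Λ, φ j (ω j)) ω = ∏ j ∈ Λ, ∑ t, φ j t := by
  unfold cfgSum
  rw [← Finset.prod_coe_sort Λ (fun j => ∑ t, φ j t),
    Fintype.prod_sum (fun (j : Λ) t => φ j t)]
  refine Finset.sum_congr rfl fun τ _ => ?_
  refine (Finset.prod_coe_sort Λ fun j => φ j (glue Λ τ ω j)).symm.trans ?_
  exact Finset.prod_congr rfl fun j _ => by rw [glue_of_mem _ _ j.2]

theorem dependsOn_cfgSum {Λ Δ : Finset V} {f : Config V → ℝ} (h : DependsOn f Δ) :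
    DependsOn (cfgSum Λ f) Δ := by
  intro ω ω' hω
  refine cfgSum_congr fun τ => h fun v hv => ?_
  by_cases hv' : v ∈ Λ
  · rw [glue_of_mem _ _ hv', glue_of_mem _ _ hv']
  · rw [glue_of_notMem _ _ hv', glue_of_notMem _ _ hv', hω v hv]

/-- The Holley inequality on a finite volume. -/
theorem cfgSum_holley {Λ : Finset V} {w w' A A' : Config V → ℝ} {ω ω' : Config V}
    (hw : ∀ ω, 0 < w ω) (hw' : ∀ ω, 0 < w' ω)
    (h : ∀ τ τ' : Λ → SignType, w (glue Λ τ ω) * w' (glue Λ τ' ω') ≤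
      w (glue Λ (τ ⊓ τ') ω) * w' (glue Λ (τ ⊔ τ') ω'))
    (hA : ∀ ω, 0 ≤ A ω) (hA' : ∀ τ : Λ → SignType, A (glue Λ τ ω) ≤ A' (glue Λ τ ω'))
    (hmono : Monotone A) :
    cfgSum Λ (fun ω => A ω * w ω) ω / cfgSum Λ w ω ≤
      cfgSum Λ (fun ω => A' ω * w' ω) ω' / cfgSum Λ w' ω' := by
  have hZ := cfgSum_pos (Λ := Λ) hw ω
  have hZ' := cfgSum_pos (Λ := Λ) hw' ω'
  have key := holley (μ := fun τ : Λ → SignType => A (glue Λ τ ω))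
    (f := fun τ => w (glue Λ τ ω) / cfgSum Λ w ω) (g := fun τ => w' (glue Λ τ ω') / cfgSum Λ w' ω')
    (fun τ => hA _) (fun τ => (div_pos (hw _) hZ).le) (fun τ => (div_pos (hw' _) hZ').le)
    (fun τ τ' hτ => hmono (glue_mono Λ hτ le_rfl))
    (by rw [← Finset.sum_div, ← Finset.sum_div]
        exact (div_self hZ.ne').trans (div_self hZ'.ne').symm)
    (fun τ τ' => by
      rw [div_mul_div_comm, div_mul_div_comm]
      exact div_le_div_of_nonneg_right (h τ τ') (mul_pos hZ hZ').le)
  simp only [← mul_div_assoc] at key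
  rw [← Finset.sum_div, ← Finset.sum_div] at key
  refine key.trans (div_le_div_of_nonneg_right (Finset.sum_le_sum fun τ _ => ?_) hZ'.le)
  exact mul_le_mul_of_nonneg_right (hA' τ) (hw' _).le

/-! ### Weights -/

theorem energy_eq (J β lam : ℝ) (E : Finset (Sym2 V)) (Λ : Finset V) (ω : Config V) :
    energy J β lam E Λ ω = J * ∑ e ∈ E, (if (e.map ω).mul = -1 then 1 else 0) -
      Real.log lam / β * ∑ i ∈ Λ, ((ω i : SignType) : ℝ) ^ 2 := rfl

theorem edge_submodular (s t s' t' : SignType) :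
    (if (s ⊓ s') * (t ⊓ t') = -1 then 1 else 0) + (if (s ⊔ s') * (t ⊔ t') = -1 then 1 else 0) ≤
      (if s * t = -1 then (1 : ℝ) else 0) + (if s' * t' = -1 then 1 else 0) := by
  -- Natural numbers instead of reals, so that the finite check can be decided.
  have : (if (s ⊓ s') * (t ⊓ t') = -1 then 1 else 0) +
      (if (s ⊔ s') * (t ⊔ t') = -1 then 1 else 0) ≤
      (if s * t = -1 then (1 : ℕ) else 0) + (if s' * t' = -1 then 1 else 0) := by
    revert s t s' t'
    decide
  exact_mod_cast this

theorem inf_sq_add_sup_sq (s t : SignType) :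
    ((s ⊓ t : SignType) : ℝ) ^ 2 + ((s ⊔ t : SignType) : ℝ) ^ 2 = (s : ℝ) ^ 2 + (t : ℝ) ^ 2 := by
  rcases le_total s t with h | h
  · rw [inf_eq_left.2 h, sup_eq_right.2 h]
  · rw [inf_eq_right.2 h, sup_eq_left.2 h, add_comm]

/-- Only the edge terms give an inequality. At a single site, meet and join merely permute the two
spins, so the activity terms balance exactly whatever the sign of `Real.log lam`. -/
theorem energy_submodular {J : ℝ} (hJ : 0 < J) (β lam : ℝ) (E : Finset (Sym2 V)) (Λ : Finset V)
    (ω ω' : Config V) :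
    energy J β lam E Λ (ω ⊓ ω') + energy J β lam E Λ (ω ⊔ ω') ≤
      energy J β lam E Λ ω + energy J β lam E Λ ω' := by
  have h1 : ∑ e ∈ E, (if (e.map (ω ⊓ ω')).mul = -1 then (1 : ℝ) else 0) +
      ∑ e ∈ E, (if (e.map (ω ⊔ ω')).mul = -1 then (1 : ℝ) else 0) ≤
      ∑ e ∈ E, (if (e.map ω).mul = -1 then (1 : ℝ) else 0) +
      ∑ e ∈ E, (if (e.map ω').mul = -1 then (1 : ℝ) else 0) := by
    rw [← Finset.sum_add_distrib, ← Finset.sum_add_distrib]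
    refine Finset.sum_le_sum fun e _ => ?_
    induction e with | _ v w
    exact edge_submodular (ω v) (ω w) (ω' v) (ω' w)
  have h2 : ∑ i ∈ Λ, (((ω ⊓ ω') i : SignType) : ℝ) ^ 2 +
      ∑ i ∈ Λ, (((ω ⊔ ω') i : SignType) : ℝ) ^ 2 =
      ∑ i ∈ Λ, ((ω i : SignType) : ℝ) ^ 2 + ∑ i ∈ Λ, ((ω' i : SignType) : ℝ) ^ 2 := by
    rw [← Finset.sum_add_distrib, ← Finset.sum_add_distrib]
    exact Finset.sum_congr rfl fun i _ => inf_sq_add_sup_sq _ _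
  simp only [energy_eq]
  have h3 := mul_le_mul_of_nonneg_left h1 hJ.le
  linear_combination h3 - Real.log lam / β * h2

theorem glue_inf_glue_le {Λ : Finset V} {τ τ' : Λ → SignType} {ω ω' : Config V} (h : ω ≤ ω') :
    glue Λ τ ω ⊓ glue Λ τ' ω' = glue Λ (τ ⊓ τ') ω := by
  funext v
  rw [Pi.inf_apply]
  by_cases hv : v ∈ Λ
  · simp [glue_of_mem _ _ hv]
  · simpa [glue_of_notMem _ _ hv] using h v

theorem glue_sup_glue_le {Λ : Finset V} {τ τ' : Λ → SignType} {ω ω' : Config V} (h : ω ≤ ω') :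
    glue Λ τ ω ⊔ glue Λ τ' ω' = glue Λ (τ ⊔ τ') ω' := by
  funext v
  rw [Pi.sup_apply]
  by_cases hv : v ∈ Λ
  · simp [glue_of_mem _ _ hv]
  · simpa [glue_of_notMem _ _ hv] using h v

theorem dependsOn_compl_cfgSum (Λ : Finset V) (f : Config V → ℝ) :
    DependsOn (cfgSum Λ f) (Λ : Set V)ᶜ := by
  intro ω ω' h
  refine cfgSum_congr fun τ => congrArg f (funext fun v => ?_)
  by_cases hv : v ∈ Λ
  · rw [glue_of_mem _ _ hv, glue_of_mem _ _ hv]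
  · rw [glue_of_notMem _ _ hv, glue_of_notMem _ _ hv]
    exact h v hv

/-! ### Local functions and events -/

theorem eq_glue_restrict_of_dependsOn {α : Type*} {Λ : Finset V} {f : Config V → α}
    (hf : DependsOn f Λ) (ω η : Config V) : f ω = f (glue Λ (Λ.restrict ω) η) :=
  hf fun v hv => by rw [glue_of_mem _ _ hv]; rfl

theorem measurable_of_dependsOn {α : Type*} [MeasurableSpace α] {Λ : Finset V} {f : Config V → α}
    (hf : DependsOn f Λ) : Measurable f := by
  have : f = (fun τ => f (glue Λ τ 0)) ∘ Λ.restrict :=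
    funext fun ω => eq_glue_restrict_of_dependsOn hf ω 0
  rw [this]
  exact (measurable_of_finite _).comp (by fun_prop)

theorem measurableSet_of_dependsOn {Λ : Finset V} {A : Set (Config V)}
    (hA : DependsOn (A.indicator (1 : Config V → ℝ)) Λ) : MeasurableSet A := by
  have : A = A.indicator (1 : Config V → ℝ) ⁻¹' {1} := by
    ext ω
    by_cases h : ω ∈ A <;> simp [h]
  rw [this]
  exact measurable_of_dependsOn hA (measurableSet_singleton 1)

/-- The increasing cylinder event `{ω ≥ σ on Λ}`. -/
def upperCylinder (Λ : Finset V) (σ : Config V) : Set (Config V) := {ω | ∀ v ∈ Λ, σ v ≤ ω v}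

theorem isUpperSet_upperCylinder (Λ : Finset V) (σ : Config V) :
    IsUpperSet (upperCylinder Λ σ) := fun _ _ h hω v hv => (hω v hv).trans (h v)

theorem dependsOn_upperCylinder (Λ : Finset V) (σ : Config V) :
    DependsOn ((upperCylinder Λ σ).indicator (1 : Config V → ℝ)) Λ := by
  intro ω ω' h
  have : ω ∈ upperCylinder Λ σ ↔ ω' ∈ upperCylinder Λ σ :=
    forall₂_congr fun v hv => by rw [h v hv]
  by_cases hω : ω ∈ upperCylinder Λ σ
  · rw [Set.indicator_of_mem hω, Set.indicator_of_mem (this.1 hω)]; rfl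
  · rw [Set.indicator_of_notMem hω, Set.indicator_of_notMem fun h' => hω (this.2 h')]

/-- Since -1 is the bottom spin, padding with it adds no constraint. This lets two cylinders be
written over a common support. -/
theorem upperCylinder_eq_of_subset {Λ Δ : Finset V} (h : Λ ⊆ Δ) (σ : Config V) :
    upperCylinder Λ σ = upperCylinder Δ (glue Λ (Λ.restrict σ) fun _ => -1) := by
  ext ω
  constructor
  · intro hω v _
    by_cases hv : v ∈ Λ
    · rw [glue_of_mem _ _ hv]; exact hω v hv
    · rw [glue_of_notMem _ _ hv]; exact SignType.neg_one_le _
  · intro hω v hv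
    have := hω v (h hv)
    rwa [glue_of_mem _ _ hv] at this

theorem isPiSystem_upperCylinder :
    IsPiSystem {A : Set (Config V) | ∃ Λ σ, A = upperCylinder Λ σ} := by
  rintro _ ⟨Λ, σ, rfl⟩ _ ⟨Δ, τ, rfl⟩ -
  rw [upperCylinder_eq_of_subset (Finset.subset_union_left (s₂ := Δ)),
    upperCylinder_eq_of_subset (Finset.subset_union_right (s₁ := Λ) (s₂ := Δ))]
  refine ⟨Λ ∪ Δ, glue Λ (Λ.restrict σ) (fun _ => -1) ⊔ glue Δ (Δ.restrict τ) (fun _ => -1), ?_⟩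
  ext ω
  simp only [upperCylinder, Set.mem_inter_iff, Set.mem_ofPred_eq, Pi.sup_apply, sup_le_iff]
  exact ⟨fun h v hv => ⟨h.1 v hv, h.2 v hv⟩,
    fun h => ⟨fun v hv => (h v hv).1, fun v hv => (h v hv).2⟩⟩

theorem generateFrom_upperCylinder :
    (inferInstance : MeasurableSpace (Config V)) =
      MeasurableSpace.generateFrom {A | ∃ Λ σ, A = upperCylinder Λ σ} := by
  refine le_antisymm (iSup_le fun v => ?_) (MeasurableSpace.generateFrom_le ?_)
  · have hIci : ∀ s : SignType, MeasurableSet[MeasurableSpace.generateFrom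
        {A : Set (Config V) | ∃ Λ σ, A = upperCylinder Λ σ}] {ω : Config V | s ≤ ω v} := by
      intro s
      refine MeasurableSpace.measurableSet_generateFrom ⟨{v}, fun _ => s, ?_⟩
      ext ω
      simp [upperCylinder]
    rw [← measurable_iff_comap_le]
    refine @measurable_to_countable' _ _ _ _ (_) _ fun s => ?_
    -- The cases come in the order 0, -1, 1. Each singleton is a Boolean combination of the
    -- half-lines above 0 and above 1.
    rcases s with _ | _ | _
    · convert MeasurableSet.inter (hIci 0) (MeasurableSet.compl (hIci 1)) using 1
      ext ω
      simp only [Set.mem_preimage, Set.mem_singleton_iff, Set.mem_inter_iff,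
        Set.mem_compl_iff, Set.mem_ofPred_eq]
      generalize ω v = t
      revert t
      decide
    · convert MeasurableSet.compl (hIci 0) using 1
      ext ω
      simp only [Set.mem_preimage, Set.mem_singleton_iff, Set.mem_compl_iff, Set.mem_ofPred_eq]
      generalize ω v = t
      revert t
      decide
    · convert (hIci 1) using 1
      ext ω
      simp only [Set.mem_preimage, Set.mem_singleton_iff, Set.mem_ofPred_eq]
      generalize ω v = t
      revert t
      decide
  · rintro _ ⟨Λ, σ, rfl⟩
    exact measurableSet_of_dependsOn (dependsOn_upperCylinder Λ σ)

/-- A probability measure on configurations is determined by its values on increasing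
cylinders. -/
theorem ext_of_upperCylinder {μ ν : Measure (Config V)} [IsFiniteMeasure μ]
    (h : ∀ Λ σ, μ (upperCylinder Λ σ) = ν (upperCylinder Λ σ)) : μ = ν := by
  refine ext_of_generate_finite _ generateFrom_upperCylinder isPiSystem_upperCylinder ?_ ?_
  · rintro _ ⟨Λ, σ, rfl⟩
    exact h Λ σ
  · have := h ∅ 0
    simpa [upperCylinder] using this

theorem measurable_glue (Λ : Finset V) (τ : Λ → SignType) : Measurable (glue Λ τ) := by
  refine measurable_pi_iff.2 fun v => ?_
  by_cases hv : v ∈ Λ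
  · simp only [glue_of_mem _ _ hv]; exact measurable_const
  · simp only [glue_of_notMem _ _ hv]; exact measurable_pi_apply v

end Spins

variable {V : Type*} {G : SimpleGraph V} {o : V} {J β lam : ℝ}

/-! ### Rooted trees -/

/-- Geodesics to `w` and `w'` extended by the last edge are both geodesics to `v`. A tree has only
one path from `o` to `v`, so their penultimate vertices agree. -/
theorem eq_of_adj_of_dist (hG : G.IsTree) {v w w' : V} (h : G.Adj w v) (h' : G.Adj w' v)
    (hd : G.dist o w + 1 = G.dist o v) (hd' : G.dist o w' + 1 = G.dist o v) : w = w' := by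
  obtain ⟨p, hp⟩ := (hG.connected o w).exists_walk_length_eq_dist
  obtain ⟨q, hq⟩ := (hG.connected o w').exists_walk_length_eq_dist
  have hp' : (p.concat h).IsPath :=
    SimpleGraph.Walk.isPath_of_length_eq_dist _ (by simp [hp, hd])
  have hq' : (q.concat h').IsPath :=
    SimpleGraph.Walk.isPath_of_length_eq_dist _ (by simp [hq, hd'])
  have := congrArg SimpleGraph.Walk.penultimate
    ((hG.existsUnique_path o v).unique hp' hq')
  simpa using this

theorem exists_parent (hG : G.IsTree) {v : V} (hv : v ≠ o) :
    ∃ w, G.Adj w v ∧ G.dist o w + 1 = G.dist o v := by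
  obtain ⟨p, hp⟩ := (hG.connected v o).exists_walk_length_eq_dist
  cases p with
  | nil => exact absurd rfl hv
  | @cons _ w _ h p =>
    refine ⟨w, h.symm, ?_⟩
    have h1 : G.dist w o ≤ p.length := G.dist_le p
    rw [SimpleGraph.Walk.length_cons, SimpleGraph.dist_comm] at hp
    rw [SimpleGraph.dist_comm] at h1
    rcases hG.dist_eq_dist_add_one_of_adj o h with h2 | h2 <;> lia

variable (G o) in
/-- The predecessor of a vertex `v ≠ o`. -/
def parent (v : V) : V :=
  if h : ∃ w, G.Adj w v ∧ G.dist o w + 1 = G.dist o v then h.choose else v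

theorem parent_spec (hG : G.IsTree) {v : V} (hv : v ≠ o) :
    G.Adj (parent G o v) v ∧ G.dist o (parent G o v) + 1 = G.dist o v := by
  rw [parent, dif_pos (exists_parent hG hv)]
  exact (exists_parent hG hv).choose_spec

theorem eq_parent (hG : G.IsTree) {v w : V} (h : G.Adj w v) (hd : G.dist o w + 1 = G.dist o v) :
    w = parent G o v := by
  have hv : v ≠ o := by rintro rfl; simp at hd
  exact eq_of_adj_of_dist hG h (parent_spec hG hv).1 hd (parent_spec hG hv).2

theorem mk_mem_innerEdges {Λ : Finset V} {v w : V} :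
    s(v, w) ∈ innerEdges G Λ ↔ v ∈ Λ ∧ w ∈ Λ ∧ G.Adj v w := by
  rw [innerEdges, Finset.mem_filter, Finset.mk_mem_sym2_iff, SimpleGraph.mem_edgeSet, and_assoc]

theorem dependsOn_energy (J β lam : ℝ) {E : Finset (Sym2 V)} {Λ : Finset V} {s : Set V}
    (hE : ∀ v w, s(v, w) ∈ E → v ∈ s ∧ w ∈ s) (hΛ : (Λ : Set V) ⊆ s) :
    DependsOn (energy J β lam E Λ) s := by
  intro ω ω' h
  rw [energy_eq, energy_eq]
  congr 2
  · refine Finset.sum_congr rfl fun e he => ?_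
    induction e with | _ v w
    change (if ω v * ω w = -1 then (1 : ℝ) else 0) = if ω' v * ω' w = -1 then 1 else 0
    rw [h v (hE v w he).1, h w (hE v w he).2]
  · exact Finset.sum_congr rfl fun i hi => by rw [h i (hΛ hi)]

theorem dependsOn_energy_innerEdges (J β lam : ℝ) (Λ : Finset V) :
    DependsOn (energy J β lam (innerEdges G Λ) Λ) Λ :=
  dependsOn_energy J β lam
    (fun _ _ h => ⟨(mk_mem_innerEdges.1 h).1, (mk_mem_innerEdges.1 h).2.1⟩) subset_rfl

variable [G.LocallyFinite]

theorem mem_ball (hG : G.IsTree) {n : ℕ} {v : V} : v ∈ ball G o n ↔ G.dist o v ≤ n := by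
  rw [ball, Set.Finite.mem_toFinset, Set.mem_ofPred_eq,
    ← (hG.connected o v).coe_dist_eq_edist, Nat.cast_le]

theorem mem_sphere (hG : G.IsTree) {n : ℕ} {v : V} : v ∈ sphere G o n ↔ G.dist o v = n := by
  rw [sphere, Finset.mem_filter, mem_ball hG, ← (hG.connected o v).coe_dist_eq_edist,
    Nat.cast_inj]
  exact ⟨And.right, fun h => ⟨h.le, h⟩⟩

theorem ball_mono (hG : G.IsTree) {m n : ℕ} (h : m ≤ n) : ball G o m ⊆ ball G o n :=
  fun _ hv => (mem_ball hG).2 (((mem_ball hG).1 hv).trans h)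

theorem sphere_subset_ball (hG : G.IsTree) (n : ℕ) : sphere G o n ⊆ ball G o n :=
  fun _ hv => (mem_ball hG).2 ((mem_sphere hG).1 hv).le

theorem ball_succ (hG : G.IsTree) (n : ℕ) : ball G o (n + 1) = ball G o n ∪ sphere G o (n + 1) := by
  ext v
  rw [Finset.mem_union, mem_ball hG, mem_ball hG, mem_sphere hG]
  lia

theorem disjoint_ball_sphere (hG : G.IsTree) (n : ℕ) :
    Disjoint (ball G o n) (sphere G o (n + 1)) := by
  rw [Finset.disjoint_left]
  intro v h1 h2
  rw [mem_ball hG] at h1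
  rw [mem_sphere hG] at h2
  lia

theorem exists_subset_ball (hG : G.IsTree) (Λ : Finset V) : ∃ n, Λ ⊆ ball G o n :=
  ⟨Λ.sup (G.dist o), fun _ hv => (mem_ball hG).2 (Finset.le_sup (f := G.dist o) hv)⟩

theorem ne_root_of_mem_sphere (hG : G.IsTree) {n : ℕ} {v : V} (h : v ∈ sphere G o (n + 1)) :
    v ≠ o := by
  rintro rfl
  rw [mem_sphere hG] at h
  simp at h

theorem parent_mem_sphere (hG : G.IsTree) {n : ℕ} {v : V} (h : v ∈ sphere G o (n + 1)) :
    parent G o v ∈ sphere G o n := by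
  have h1 := (parent_spec hG (ne_root_of_mem_sphere hG h)).2
  rw [mem_sphere hG] at h ⊢
  lia

/-- The children are the neighbours other than the parent. With `1 ≤ n` the root never occurs as
`v`, so its degree is irrelevant and both kinds of tree are covered at once. -/
theorem card_children {k : ℕ} (hG : IsRootedCayleyTree G o k) {n : ℕ} (hn : 1 ≤ n) {v : V}
    (hv : v ∈ sphere G o n) :
    ((sphere G o (n + 1)).filter fun w => parent G o w = v).card = k := by
  obtain ⟨hT, hdeg, -⟩ := hG
  have hvo : v ≠ o := by
    rintro rfl
    rw [mem_sphere hT] at hv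
    simp at hv
    lia
  obtain ⟨hp, hpd⟩ := parent_spec hT hvo
  have : (sphere G o (n + 1)).filter (fun w => parent G o w = v) =
      (G.neighborFinset v).erase (parent G o v) := by
    ext w
    rw [Finset.mem_filter, Finset.mem_erase, SimpleGraph.mem_neighborFinset, mem_sphere hT]
    rw [mem_sphere hT] at hv
    constructor
    · rintro ⟨hw, rfl⟩
      have hwo : w ≠ o := by rintro rfl; simp at hw
      refine ⟨?_, (parent_spec hT hwo).1⟩
      rintro h
      rw [← h] at hpd
      lia
    · rintro ⟨hne, hadj⟩
      rcases hT.dist_eq_dist_add_one_of_adj o hadj with h | h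
      · exact absurd (eq_parent hT hadj.symm h.symm) hne
      · exact ⟨by lia, (eq_parent hT hadj h.symm).symm⟩
  rw [this, Finset.card_erase_of_mem ((SimpleGraph.mem_neighborFinset _ _ _).2 hp.symm),
    SimpleGraph.card_neighborFinset_eq_degree, hdeg v hvo, Nat.add_sub_cancel]

theorem sphere_one_nonempty {k : ℕ} (hk : 0 < k) (hG : IsRootedCayleyTree G o k) :
    (sphere G o 1).Nonempty := by
  have : 0 < G.degree o := by rcases hG.2.2 with h | h <;> lia
  obtain ⟨w, hw⟩ := (SimpleGraph.degree_pos_iff_exists_adj _ _).1 this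
  exact ⟨w, (mem_sphere hG.1).2 (SimpleGraph.dist_eq_one_iff_adj.2 hw)⟩

/-! ### Edges in and around balls -/

theorem mk_mem_touchingEdges {Λ : Finset V} {v w : V} :
    s(v, w) ∈ touchingEdges G Λ ↔ (v ∈ Λ ∨ w ∈ Λ) ∧ G.Adj v w := by
  rw [touchingEdges, Finset.mem_biUnion]
  simp only [SimpleGraph.mem_incidenceFinset, SimpleGraph.incidenceSet, Set.mem_ofPred_eq,
    SimpleGraph.mem_edgeSet, Sym2.mem_iff]
  grind

theorem touchingEdges_ball (hG : G.IsTree) (n : ℕ) :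
    touchingEdges G (ball G o n) = innerEdges G (ball G o (n + 1)) := by
  ext e
  induction e with | _ v w
  rw [mk_mem_touchingEdges, mk_mem_innerEdges, mem_ball hG, mem_ball hG, mem_ball hG, mem_ball hG]
  constructor
  · rintro ⟨h, hadj⟩
    rcases hG.dist_eq_dist_add_one_of_adj o hadj with h1 | h1 <;> refine ⟨?_, ?_, hadj⟩ <;> lia
  · rintro ⟨h1, h2, hadj⟩
    rcases hG.dist_eq_dist_add_one_of_adj o hadj with h1 | h1 <;> refine ⟨?_, hadj⟩ <;> lia

/-- Edges of a tree join consecutive levels, so each new edge joins exactly one new vertex to its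
parent. -/
theorem sum_innerEdges_succ (hG : G.IsTree) (n : ℕ) (f : Sym2 V → ℝ) :
    ∑ e ∈ innerEdges G (ball G o (n + 1)), f e =
      ∑ e ∈ innerEdges G (ball G o n), f e +
        ∑ j ∈ sphere G o (n + 1), f s(parent G o j, j) := by
  have hinj : Set.InjOn (fun j => s(parent G o j, j)) (sphere G o (n + 1) : Set V) := by
    intro i hi j hj hij
    have h1 := parent_mem_sphere hG (Finset.mem_coe.1 hi)
    rw [Finset.mem_coe, mem_sphere hG] at hi hj
    rw [mem_sphere hG] at h1
    rcases Sym2.eq_iff.1 hij with h | h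
    · exact h.2
    · rw [h.1] at h1; lia
  have hunion : innerEdges G (ball G o (n + 1)) = innerEdges G (ball G o n) ∪
      (sphere G o (n + 1)).image (fun j => s(parent G o j, j)) := by
    ext e
    induction e with | _ v w
    simp only [Finset.mem_union, mk_mem_innerEdges, Finset.mem_image, mem_ball hG]
    constructor
    · rintro ⟨h1, h2, hadj⟩
      rcases hG.dist_eq_dist_add_one_of_adj o hadj with h3 | h3
      · rcases Nat.lt_or_ge n (G.dist o v) with h4 | h4
        · refine Or.inr ⟨v, (mem_sphere hG).2 (by lia), ?_⟩
          rw [← eq_parent hG hadj.symm h3.symm, Sym2.eq_swap]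
        · exact Or.inl ⟨h4, by lia, hadj⟩
      · rcases Nat.lt_or_ge n (G.dist o w) with h4 | h4
        · refine Or.inr ⟨w, (mem_sphere hG).2 (by lia), ?_⟩
          rw [← eq_parent hG hadj h3.symm]
        · exact Or.inl ⟨by lia, h4, hadj⟩
    · rintro (⟨h1, h2, hadj⟩ | ⟨j, hj, hjvw⟩)
      · exact ⟨by lia, by lia, hadj⟩
      · have h1 := parent_spec hG (ne_root_of_mem_sphere hG hj)
        rw [mem_sphere hG] at hj
        rcases Sym2.eq_iff.1 hjvw with ⟨rfl, rfl⟩ | ⟨rfl, rfl⟩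
        · exact ⟨by lia, by lia, h1.1⟩
        · exact ⟨by lia, by lia, h1.1.symm⟩
  have hdisj : Disjoint (innerEdges G (ball G o n))
      ((sphere G o (n + 1)).image (fun j => s(parent G o j, j))) := by
    rw [Finset.disjoint_left]
    intro e he he'
    obtain ⟨j, hj, rfl⟩ := Finset.mem_image.1 he'
    exact Finset.disjoint_left.1 (disjoint_ball_sphere hG n) (mk_mem_innerEdges.1 he).2.1 hj
  rw [hunion, Finset.sum_union hdisj, Finset.sum_image hinj]

theorem gibbsSpec_eq (J β lam : ℝ) (Λ : Finset V) (ω : Config V) (A : Set (Config V)) :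
    gibbsSpec G J β lam Λ ω A =
      cfgSum Λ (fun ω => A.indicator 1 ω * Real.exp (-β * energy J β lam (touchingEdges G Λ) Λ ω))
        ω / cfgSum Λ (fun ω => Real.exp (-β * energy J β lam (touchingEdges G Λ) Λ ω)) ω := by
  unfold gibbsSpec cfgSum gibbsWeight
  congr 1
  refine Finset.sum_congr rfl fun τ _ => ?_
  by_cases h : glue Λ τ ω ∈ A <;> simp [h]

/-- The finite-volume Gibbs distributions are stochastically increasing in the boundary
condition. -/
theorem gibbsSpec_mono {J β : ℝ} (hJ : 0 < J) (hβ : 0 < β) (lam : ℝ) (Λ : Finset V)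
    {A : Set (Config V)} (hA : IsUpperSet A) :
    Monotone fun ω => gibbsSpec G J β lam Λ ω A := by
  intro ω ω' h
  have hmono : Monotone (A.indicator (1 : Config V → ℝ)) := by
    intro a b hab
    by_cases ha : a ∈ A
    · simp [ha, hA hab ha]
    · rw [Set.indicator_of_notMem ha]
      exact Set.indicator_nonneg (fun _ _ => zero_le_one) _
  simp only [gibbsSpec_eq]
  refine cfgSum_holley (fun ω => Real.exp_pos _) (fun ω => Real.exp_pos _) (fun τ τ' => ?_)
    (fun ω => Set.indicator_nonneg (fun _ _ => zero_le_one) _)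
    (fun τ => hmono (glue_mono _ le_rfl h)) hmono
  rw [← Real.exp_add, ← Real.exp_add, Real.exp_le_exp, ← glue_inf_glue_le h, ← glue_sup_glue_le h]
  have := mul_le_mul_of_nonneg_left (energy_submodular hJ β lam (touchingEdges G Λ) Λ
    (glue Λ τ ω) (glue Λ τ' ω')) hβ.le
  linarith

/-! ### Summing out the outermost layer -/

theorem splittingWeight_pos (h : V → SignType → ℝ) (n : ℕ) (ω : Config V) :
    0 < splittingWeight G o J β lam h n ω := Real.exp_pos _

theorem dependsOn_splittingWeight (hG : G.IsTree) (h : V → SignType → ℝ) (n : ℕ) :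
    DependsOn (splittingWeight G o J β lam h n) (ball G o n) := by
  intro ω ω' hω
  unfold splittingWeight
  rw [dependsOn_energy_innerEdges J β lam (ball G o n) hω]
  congr 2
  exact Finset.sum_congr rfl fun i hi => by rw [hω i (sphere_subset_ball hG n hi)]

theorem splittingWeight_eq_mul_prod (h : V → SignType → ℝ) (n : ℕ) (ω : Config V) :
    splittingWeight G o J β lam h n ω =
      splittingWeight G o J β lam 0 n ω * ∏ i ∈ sphere G o n, Real.exp (h i (ω i)) := by
  simp only [splittingWeight, Pi.zero_apply, Finset.sum_const_zero, add_zero, Real.exp_add,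
    Real.exp_sum]

theorem energy_ball_succ (hG : G.IsTree) (n : ℕ) (Λ : Finset V) (ω : Config V) :
    -β * energy J β lam (innerEdges G (ball G o (n + 1))) Λ ω =
      -β * energy J β lam (innerEdges G (ball G o n)) Λ ω +
      ∑ j ∈ sphere G o (n + 1), -(J * β) * (if ω (parent G o j) * ω j = -1 then 1 else 0) := by
  have h := sum_innerEdges_succ (o := o) hG n
    (fun e => if (e.map ω).mul = -1 then (1 : ℝ) else 0)
  change _ = _ + ∑ j ∈ sphere G o (n + 1), (if ω (parent G o j) * ω j = -1 then (1 : ℝ) else 0)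
    at h
  rw [energy_eq, energy_eq, h, ← Finset.mul_sum]
  ring

theorem energy_union (hβ : 0 < β) (E : Finset (Sym2 V)) {Λ Δ : Finset V} (h : Disjoint Λ Δ)
    (ω : Config V) :
    -β * energy J β lam E (Λ ∪ Δ) ω =
      -β * energy J β lam E Λ ω + ∑ j ∈ Δ, Real.log lam * ((ω j : SignType) : ℝ) ^ 2 := by
  rw [energy_eq, energy_eq, Finset.sum_union h, ← Finset.mul_sum]
  field_simp
  ring

/-- Given the spins in the smaller ball, the outermost spins are independent: each interacts only
with its parent. -/
theorem splittingWeight_succ (hG : G.IsTree) (hβ : 0 < β) (h : V → SignType → ℝ) (n : ℕ)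
    (ω : Config V) :
    splittingWeight G o J β lam h (n + 1) ω = splittingWeight G o J β lam 0 n ω *
      ∏ j ∈ sphere G o (n + 1),
        Real.exp (-(J * β) * (if ω (parent G o j) * ω j = -1 then 1 else 0) +
          Real.log lam * ((ω j : SignType) : ℝ) ^ 2 + h j (ω j)) := by
  rw [← Real.exp_sum]
  simp only [splittingWeight, Pi.zero_apply, Finset.sum_const_zero, add_zero, ← Real.exp_add]
  rw [energy_ball_succ hG, ball_succ hG, energy_union hβ _ (disjoint_ball_sphere hG n),
    Finset.sum_add_distrib, Finset.sum_add_distrib]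
  congr 1
  ring

/-- Here the layer `n + 1` is boundary condition, so unlike in `splittingWeight_succ` its spins
contribute edge factors only, with no activity and no field. -/
theorem gibbsWeight_ball (hG : G.IsTree) (n : ℕ) (ω : Config V) :
    Real.exp (-β * energy J β lam (touchingEdges G (ball G o n)) (ball G o n) ω) =
      splittingWeight G o J β lam 0 n ω *
      ∏ j ∈ sphere G o (n + 1),
        Real.exp (-(J * β) * (if ω (parent G o j) * ω j = -1 then 1 else 0)) := by
  rw [touchingEdges_ball hG, energy_ball_succ hG, Real.exp_add, Real.exp_sum]
  simp only [splittingWeight, Pi.zero_apply, Finset.sum_const_zero, add_zero]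

theorem prod_sphere_succ {k : ℕ} (hG : IsRootedCayleyTree G o k) {n : ℕ} (hn : 1 ≤ n)
    (f : V → ℝ) :
    ∏ j ∈ sphere G o (n + 1), f (parent G o j) = ∏ i ∈ sphere G o n, f i ^ k := by
  rw [← Finset.prod_fiberwise_of_maps_to (fun j hj => parent_mem_sphere hG.1 hj)]
  refine Finset.prod_congr rfl fun i hi => ?_
  rw [← card_children hG hn hi, ← Finset.prod_const]
  exact Finset.prod_congr rfl fun j hj => by rw [(Finset.mem_filter.1 hj).2]

theorem parent_notMem_sphere (hG : G.IsTree) {n : ℕ} {j : V} (hj : j ∈ sphere G o (n + 1)) :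
    parent G o j ∉ sphere G o (n + 1) := by
  have h1 := parent_mem_sphere hG hj
  rw [mem_sphere hG] at h1 ⊢
  lia

theorem cfgSum_sphere_splittingWeight (hG : G.IsTree) (hβ : 0 < β) (h : V → SignType → ℝ) (n : ℕ)
    (ω : Config V) :
    cfgSum (sphere G o (n + 1)) (splittingWeight G o J β lam h (n + 1)) ω =
      splittingWeight G o J β lam 0 n ω *
      ∏ j ∈ sphere G o (n + 1), ∑ t : SignType,
        Real.exp (-(J * β) * (if ω (parent G o j) * t = -1 then 1 else 0) +
          Real.log lam * (t : ℝ) ^ 2 + h j t) := by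
  rw [← cfgSum_prod _ _ ω, ← cfgSum_const_mul]
  refine cfgSum_congr fun τ => ?_
  rw [splittingWeight_succ hG hβ]
  congr 1
  · refine dependsOn_splittingWeight hG 0 n fun v hv => glue_of_notMem _ _ fun hv' => ?_
    exact Finset.disjoint_left.1 (disjoint_ball_sphere hG n) hv hv'
  · refine Finset.prod_congr rfl fun j hj => ?_
    rw [glue_of_notMem _ _ (parent_notMem_sphere hG hj)]

/-- The fields of the boundary law `p`. -/
def lawField (lam : ℝ) (p : ℝ × ℝ) (s : SignType) : ℝ :=
  if s = 1 then Real.log (p.1 / lam) else if s = -1 then Real.log (p.2 / lam) else 0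

/-- This is where the boundary law equations come from. A child contributes `1 + x + y`, `1 + x + θ
y` or `1 + θ x + y` when its parent has spin 0, 1 or -1. Pulling out the value at spin 0 from the
`k` children leaves the fields of the next law. -/
theorem sum_exp_lawField (hlam : 0 < lam) {p : ℝ × ℝ} (hp : 0 < p.1 ∧ 0 < p.2) (k : ℕ)
    (s : SignType) :
    (∑ t : SignType, Real.exp (-(J * β) * (if s * t = -1 then 1 else 0) +
      Real.log lam * (t : ℝ) ^ 2 + lawField lam p t)) ^ k =
      (1 + p.1 + p.2) ^ k *
        Real.exp (lawField lam (lawStep k (Real.exp (-J * β)) lam p) s) := by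
  obtain ⟨hx, hy⟩ := hp
  have hθ := Real.exp_pos (-J * β)
  have hD : 0 < 1 + p.1 + p.2 := by linarith
  have e1 : Real.exp (Real.log lam + Real.log (p.1 / lam)) = p.1 := by
    rw [Real.exp_add, Real.exp_log hlam, Real.exp_log (div_pos hx hlam)]
    field_simp
  have e2 : Real.exp (Real.log lam + Real.log (p.2 / lam)) = p.2 := by
    rw [Real.exp_add, Real.exp_log hlam, Real.exp_log (div_pos hy hlam)]
    field_simp
  have hJβ : -(J * β) = -J * β := by ring
  have hsum : ∀ f : SignType → ℝ, ∑ t, f t = f 0 + f (-1) + f 1 := by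
    intro f
    rw [show (Finset.univ : Finset SignType) = {0, -1, 1} from rfl, Finset.sum_insert (by decide),
      Finset.sum_insert (by decide), Finset.sum_singleton, add_assoc]
  rw [hsum]
  have hstep : ∀ r : ℝ, 0 < r →
      Real.exp (Real.log (lam * (r / (1 + p.1 + p.2)) ^ k / lam)) =
        (r / (1 + p.1 + p.2)) ^ k := by
    intro r hr
    rw [Real.exp_log (by positivity)]
    field_simp
  have t0 : ∀ a, Real.exp (-(J * β) * a + Real.log lam * ((0 : SignType) : ℝ) ^ 2 +
      lawField lam p 0) = Real.exp (-(J * β) * a) := by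
    intro a; simp [lawField]
  have t1 : ∀ a, Real.exp (-(J * β) * a + Real.log lam * ((1 : SignType) : ℝ) ^ 2 +
      lawField lam p 1) = Real.exp (-(J * β) * a) * p.1 := by
    intro a; simp [lawField, add_assoc, Real.exp_add _ (_ + _), e1]
  have t2 : ∀ a, Real.exp (-(J * β) * a + Real.log lam * ((-1 : SignType) : ℝ) ^ 2 +
      lawField lam p (-1)) = Real.exp (-(J * β) * a) * p.2 := by
    intro a; simp [lawField, add_assoc, Real.exp_add _ (_ + _), e2]
  rw [t0, t1, t2]
  rcases s with _ | _ | _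
  · simp [lawField, add_right_comm]
  · have h1 := hstep (1 + Real.exp (-J * β) * p.1 + p.2) (by positivity)
    simp only [SignType.neg_eq_neg_one, lawField, lawStep]
    simp only [show ¬ ((-1 : SignType) = 1) by decide, if_false, if_true, h1, ← mul_pow]
    simp only [show ¬ ((0 : SignType) = -1) by decide, show ¬ ((-1 : SignType) * -1 = -1) by decide,
      mul_one, if_false, if_true, mul_zero, Real.exp_zero, one_mul, hJβ]
    congr 1
    field_simp
    ring
  · have h1 := hstep (1 + p.1 + Real.exp (-J * β) * p.2) (by positivity)
    simp only [SignType.pos_eq_one, lawField, lawStep]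
    simp only [if_true, h1, ← mul_pow]
    simp only [show ¬ ((1 : SignType) = -1) by decide, mul_one, one_mul,
      show ¬ ((0 : SignType) = -1) by decide, if_false, if_true, mul_zero, Real.exp_zero, hJβ]
    congr 1
    field_simp
    ring

theorem cfgSum_sphere_lawField {k : ℕ} (hG : IsRootedCayleyTree G o k) (hβ : 0 < β)
    (hlam : 0 < lam) {p : ℝ × ℝ} (hp : 0 < p.1 ∧ 0 < p.2) {n : ℕ} (hn : 1 ≤ n) (ω : Config V) :
    cfgSum (sphere G o (n + 1))
        (splittingWeight G o J β lam (fun _ => lawField lam p) (n + 1)) ω =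
      ((1 + p.1 + p.2) ^ k) ^ (sphere G o n).card * splittingWeight G o J β lam
        (fun _ => lawField lam (lawStep k (Real.exp (-J * β)) lam p)) n ω := by
  rw [cfgSum_sphere_splittingWeight hG.1 hβ, splittingWeight_eq_mul_prod (fun _ => lawField _ _),
    prod_sphere_succ hG hn (fun i => ∑ t : SignType, Real.exp (-(J * β) *
      (if ω i * t = -1 then 1 else 0) + Real.log lam * (t : ℝ) ^ 2 + lawField lam p t))]
  simp only [sum_exp_lawField hlam hp]
  rw [Finset.prod_mul_distrib, Finset.prod_const]
  ring

/-! ### Expectations in finite volume -/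

variable (G o J β lam) in
/-- The expectation of `f` under the finite-volume distribution on `V_n` with boundary fields
`h`. -/
def mean (h : V → SignType → ℝ) (n : ℕ) (f : Config V → ℝ) : ℝ :=
  cfgSum (ball G o n) (fun ω => f ω * splittingWeight G o J β lam h n ω) 0 /
    cfgSum (ball G o n) (splittingWeight G o J β lam h n) 0

variable (G o J β lam) in
/-- The expectation of `f` under the finite-volume distribution on `V_n` with the boundary law
`p`. -/
abbrev lawMean (p : ℝ × ℝ) (n : ℕ) (f : Config V → ℝ) : ℝ :=
  mean G o J β lam (fun _ => lawField lam p) n f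

theorem mean_eq_sum (h : V → SignType → ℝ) (n : ℕ) (f : Config V → ℝ) :
    mean G o J β lam h n f = ∑ τ : ball G o n → SignType,
      f (glue (ball G o n) τ 0) * splittingProb G o J β lam h n (glue (ball G o n) τ 0) := by
  simp only [mean, splittingProb, cfgSum, Finset.sum_div, mul_div_assoc]

theorem mean_one (h : V → SignType → ℝ) (n : ℕ) :
    mean G o J β lam h n (fun _ => 1) = 1 := by
  simp only [mean, one_mul]
  exact div_self (cfgSum_pos (splittingWeight_pos h n) _).ne'

/-- Summing out the outer layer multiplies numerator and denominator by the same spin-independent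
constant, so only the law changes. -/
theorem lawMean_succ {k : ℕ} (hG : IsRootedCayleyTree G o k) (hβ : 0 < β)
    (hlam : 0 < lam) {p : ℝ × ℝ} (hp : 0 < p.1 ∧ 0 < p.2) {n : ℕ} (hn : 1 ≤ n)
    {f : Config V → ℝ} (hf : DependsOn f (ball G o n)) :
    lawMean G o J β lam p (n + 1) f =
      lawMean G o J β lam (lawStep k (Real.exp (-J * β)) lam p) n f := by
  have hdisj := disjoint_ball_sphere (o := o) hG.1 n
  have hC : 0 < ((1 + p.1 + p.2) ^ k) ^ (sphere G o n).card := by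
    have := hp.1; have := hp.2; positivity
  have key : ∀ g : Config V → ℝ, DependsOn g (ball G o n) →
      cfgSum (ball G o (n + 1)) (fun ω => g ω *
        splittingWeight G o J β lam (fun _ => lawField lam p) (n + 1) ω) 0 =
      ((1 + p.1 + p.2) ^ k) ^ (sphere G o n).card * cfgSum (ball G o n) (fun ω => g ω *
        splittingWeight G o J β lam
          (fun _ => lawField lam (lawStep k (Real.exp (-J * β)) lam p)) n ω) 0 := by
    intro g hg
    rw [ball_succ hG.1, cfgSum_union hdisj, ← cfgSum_const_mul]
    refine cfgSum_congr fun τ => ?_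
    rw [cfgSum_mul_left hg (Finset.disjoint_coe.2 hdisj), cfgSum_sphere_lawField hG hβ hlam hp hn]
    ring
  have key1 := key (fun _ => 1) (fun _ _ _ => rfl)
  simp only [one_mul] at key1
  unfold lawMean mean
  rw [key f hf, key1, mul_div_mul_left _ _ hC.ne']

theorem lawMean_add {k : ℕ} (hG : IsRootedCayleyTree G o k) (hβ : 0 < β)
    (hlam : 0 < lam) {p : ℝ × ℝ} (hp : 0 < p.1 ∧ 0 < p.2) {n : ℕ} (hn : 1 ≤ n)
    {f : Config V → ℝ} (hf : DependsOn f (ball G o n)) (j : ℕ) :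
    lawMean G o J β lam p (n + j) f =
      lawMean G o J β lam ((lawStep k (Real.exp (-J * β)) lam)^[j] p) n f := by
  induction j generalizing p with
  | zero => rfl
  | succ j ih =>
    rw [← add_assoc, lawMean_succ hG hβ hlam hp (by lia), ih (lawStep_pos (Real.exp_pos _) hlam hp),
      Function.iterate_succ_apply]
    exact fun ω ω' h => hf fun v hv => h v (ball_mono hG.1 (by lia) hv)

theorem tendsto_lawMean {u : ℕ → ℝ × ℝ} {q : ℝ × ℝ} (hlam : 0 < lam) (hq : 0 < q.1 ∧ 0 < q.2)
    (hu : Tendsto u atTop (𝓝 q)) (n : ℕ) (f : Config V → ℝ) :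
    Tendsto (fun j => lawMean G o J β lam (u j) n f) atTop (𝓝 (lawMean G o J β lam q n f)) := by
  have h1 : Tendsto (fun j => (u j).1) atTop (𝓝 q.1) := (continuous_fst.tendsto q).comp hu
  have h2 : Tendsto (fun j => (u j).2) atTop (𝓝 q.2) := (continuous_snd.tendsto q).comp hu
  have hfield : ∀ s, Tendsto (fun j => lawField lam (u j) s) atTop (𝓝 (lawField lam q s)) := by
    intro s
    unfold lawField
    split_ifs
    · exact (h1.div_const lam).log (div_pos hq.1 hlam).ne'
    · exact (h2.div_const lam).log (div_pos hq.2 hlam).ne'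
    · exact tendsto_const_nhds
  have hw : ∀ ω, Tendsto (fun j => splittingWeight G o J β lam (fun _ => lawField lam (u j)) n ω)
      atTop (𝓝 (splittingWeight G o J β lam (fun _ => lawField lam q) n ω)) := by
    intro ω
    exact (Real.continuous_exp.tendsto _).comp
      (tendsto_const_nhds.add (tendsto_finsetSum _ fun i _ => hfield _))
  refine Tendsto.div ?_ ?_ (cfgSum_pos (splittingWeight_pos _ n) _).ne'
  · exact tendsto_finsetSum _ fun τ _ => (hw _).const_mul _
  · exact tendsto_finsetSum _ fun τ _ => hw _

/-- A constant boundary condition `ε` outside `V_n` acts like a boundary law. -/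
theorem gibbsSpec_ball_const {k : ℕ} (hG : IsRootedCayleyTree G o k) {n : ℕ}
    (hn : 1 ≤ n) {A : Set (Config V)} (hA : DependsOn (A.indicator (1 : Config V → ℝ)) (ball G o n))
    {ε : SignType} {p : ℝ × ℝ}
    (hε : ∀ s : SignType, Real.exp (-(J * β) * (if s * ε = -1 then 1 else 0)) ^ k =
      Real.exp (lawField lam p s)) :
    gibbsSpec G J β lam (ball G o n) (fun _ => ε) A =
      lawMean G o J β lam p n (A.indicator 1) := by
  have key : ∀ τ : ball G o n → SignType,
      Real.exp (-β * energy J β lam (touchingEdges G (ball G o n)) (ball G o n)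
        (glue (ball G o n) τ fun _ => ε)) =
      splittingWeight G o J β lam (fun _ => lawField lam p) n (glue (ball G o n) τ 0) := by
    intro τ
    have h1 : ∏ j ∈ sphere G o (n + 1), Real.exp (-(J * β) *
        (if glue (ball G o n) τ (fun _ => ε) (parent G o j) *
          glue (ball G o n) τ (fun _ => ε) j = -1 then 1 else 0)) =
        ∏ j ∈ sphere G o (n + 1), Real.exp (-(J * β) *
        (if glue (ball G o n) τ (fun _ => ε) (parent G o j) * ε = -1 then 1 else 0)) :=
      Finset.prod_congr rfl fun j hj => by
        rw [glue_of_notMem τ (fun _ => ε) (v := j)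
          fun hj' => Finset.disjoint_left.1 (disjoint_ball_sphere hG.1 n) hj' hj]
    rw [gibbsWeight_ball hG.1, h1, prod_sphere_succ hG hn (fun i => Real.exp (-(J * β) *
        (if glue (ball G o n) τ (fun _ => ε) i * ε = -1 then 1 else 0)))]
    simp only [hε]
    rw [← splittingWeight_eq_mul_prod (fun _ => lawField lam p)]
    exact dependsOn_splittingWeight hG.1 _ n fun v hv => by
      rw [glue_of_mem _ _ hv, glue_of_mem _ _ hv]
  rw [gibbsSpec_eq, lawMean, mean]
  congr 1
  · refine cfgSum_congr fun τ => ?_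
    rw [key]
    congr 1
    exact hA fun v hv => by rw [glue_of_mem _ _ hv, glue_of_mem _ _ hv]
  · exact cfgSum_congr key

/-- A boundary site of the ball has `k` plus neighbours outside. They cost a factor `θ ^ k` if its
spin is -1 and nothing otherwise, which fixes the ratios `x / lam = 1` and `y / lam = θ ^ k`. -/
theorem gibbsSpec_ball_one {k : ℕ} (hG : IsRootedCayleyTree G o k) (hlam : 0 < lam)
    {n : ℕ} (hn : 1 ≤ n) {A : Set (Config V)}
    (hA : DependsOn (A.indicator (1 : Config V → ℝ)) (ball G o n)) :
    gibbsSpec G J β lam (ball G o n) (fun _ => 1) A =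
      lawMean G o J β lam (lam, lam * Real.exp (-J * β) ^ k) n (A.indicator 1) := by
  refine gibbsSpec_ball_const hG hn hA fun s => ?_
  have h : Real.exp (Real.log (lam * Real.exp (-J * β) ^ k / lam)) = Real.exp (-J * β) ^ k := by
    rw [Real.exp_log (by positivity), mul_div_cancel_left₀ _ hlam.ne']
  rw [neg_mul] at h
  rcases s with _ | _ | _
  · simp [lawField]
  · simp [lawField, h]
  · simp [lawField, hlam.ne']

theorem gibbsSpec_ball_neg_one {k : ℕ} (hG : IsRootedCayleyTree G o k) (hlam : 0 < lam)
    {n : ℕ} (hn : 1 ≤ n) {A : Set (Config V)}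
    (hA : DependsOn (A.indicator (1 : Config V → ℝ)) (ball G o n)) :
    gibbsSpec G J β lam (ball G o n) (fun _ => -1) A =
      lawMean G o J β lam (lam * Real.exp (-J * β) ^ k, lam) n (A.indicator 1) := by
  refine gibbsSpec_ball_const hG hn hA fun s => ?_
  have h : Real.exp (Real.log (lam * Real.exp (-J * β) ^ k / lam)) = Real.exp (-J * β) ^ k := by
    rw [Real.exp_log (by positivity), mul_div_cancel_left₀ _ hlam.ne']
  rw [neg_mul] at h
  rcases s with _ | _ | _
  · simp [lawField]
  · simp [lawField, hlam.ne']
  · simp [lawField, h]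

/-! ### Splitting Gibbs measures as measures -/

theorem splittingProb_nonneg (h : V → SignType → ℝ) (n : ℕ) (ω : Config V) :
    0 ≤ splittingProb G o J β lam h n ω :=
  div_nonneg (splittingWeight_pos _ _ _).le
    (Finset.sum_nonneg fun _ _ => (splittingWeight_pos _ _ _).le)

theorem IsSplittingGibbs.lintegral_eq {h : V → SignType → ℝ} {μ : Measure (Config V)}
    (hμ : IsSplittingGibbs G o J β lam h μ) {n : ℕ} (hn : 1 ≤ n) {f : Config V → ℝ}
    (hf0 : ∀ ω, 0 ≤ f ω) (hf : DependsOn f (ball G o n)) :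
    ∫⁻ ω, ENNReal.ofReal (f ω) ∂μ = ENNReal.ofReal (mean G o J β lam h n f) := by
  have h1 : ∫⁻ ω, ENNReal.ofReal (f ω) ∂μ =
      ∫⁻ τ, ENNReal.ofReal (f (glue (ball G o n) τ 0)) ∂(μ.map (ball G o n).restrict) := by
    rw [lintegral_map (measurable_of_finite _) (by fun_prop)]
    exact lintegral_congr fun ω => by rw [← eq_glue_restrict_of_dependsOn hf]
  rw [h1, lintegral_fintype, mean_eq_sum, ENNReal.ofReal_sum_of_nonneg
    fun τ _ => mul_nonneg (hf0 _) (splittingProb_nonneg _ _ _)]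
  refine Finset.sum_congr rfl fun τ _ => ?_
  rw [ENNReal.ofReal_mul (hf0 _), ← hμ.2 n hn, Measure.map_apply (by fun_prop)
    (measurableSet_singleton _)]
  congr 2
  ext ω
  simp only [Set.mem_preimage, Set.mem_singleton_iff, Set.mem_ofPred_eq]
  constructor
  · rintro rfl i hi
    rw [glue_of_mem _ _ hi]; rfl
  · intro h
    funext i
    rw [← glue_of_mem τ 0 i.2]
    exact h i i.2

theorem IsSplittingGibbs.measure_eq {h : V → SignType → ℝ} {μ : Measure (Config V)}
    (hμ : IsSplittingGibbs G o J β lam h μ) {n : ℕ} (hn : 1 ≤ n) {A : Set (Config V)}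
    (hA : DependsOn (A.indicator (1 : Config V → ℝ)) (ball G o n)) :
    μ A = ENNReal.ofReal (mean G o J β lam h n (A.indicator 1)) := by
  rw [← hμ.lintegral_eq hn (f := A.indicator 1)
      (fun ω => Set.indicator_nonneg (fun _ _ => zero_le_one) _) hA,
    ← lintegral_indicator_one (measurableSet_of_dependsOn hA)]
  refine lintegral_congr fun ω => ?_
  by_cases h : ω ∈ A <;> simp [h]

theorem exists_subset_ball_ge (hG : G.IsTree) (Λ : Finset V) (m : ℕ) :
    ∃ n, m ≤ n ∧ Λ ⊆ ball G o n := by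
  obtain ⟨n, hn⟩ := exists_subset_ball (o := o) hG Λ
  exact ⟨max m n, le_max_left _ _, hn.trans (ball_mono hG (le_max_right _ _))⟩

theorem IsSplittingGibbs.unique (hG : G.IsTree) {h : V → SignType → ℝ} {μ ν : Measure (Config V)}
    (hμ : IsSplittingGibbs G o J β lam h μ) (hν : IsSplittingGibbs G o J β lam h ν) : μ = ν := by
  have := hμ.1
  refine ext_of_upperCylinder fun Λ σ => ?_
  obtain ⟨n, hn, hΛ⟩ := exists_subset_ball_ge (o := o) hG Λ 1
  have hA := (dependsOn_upperCylinder Λ σ).mono (Finset.coe_subset.2 hΛ)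
  rw [hμ.measure_eq hn hA, hν.measure_eq hn hA]

/-! ### Existence -/

variable (G o J β lam) in
/-- The finite-volume distribution on `V_n`, continued by zero spins. -/
def finiteMeasure (h : V → SignType → ℝ) (n : ℕ) : Measure (Config V) :=
  ∑ τ : ball G o n → SignType, ENNReal.ofReal (splittingProb G o J β lam h n
    (glue (ball G o n) τ 0)) • Measure.dirac (glue (ball G o n) τ 0)

theorem finiteMeasure_apply (h : V → SignType → ℝ) (n : ℕ) {A : Set (Config V)}
    (hA : MeasurableSet A) :
    finiteMeasure G o J β lam h n A = ENNReal.ofReal (mean G o J β lam h n (A.indicator 1)) := by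
  rw [finiteMeasure, Measure.finsetSum_apply, mean_eq_sum, ENNReal.ofReal_sum_of_nonneg]
  · refine Finset.sum_congr rfl fun τ _ => ?_
    rw [Measure.smul_apply, Measure.dirac_apply' _ hA]
    by_cases h : glue (ball G o n) τ 0 ∈ A <;> simp [h]
  · exact fun τ _ => mul_nonneg (Set.indicator_nonneg (fun _ _ => zero_le_one) _)
      (splittingProb_nonneg _ _ _)

instance (h : V → SignType → ℝ) (n : ℕ) :
    IsProbabilityMeasure (finiteMeasure G o J β lam h n) := by
  constructor
  rw [finiteMeasure_apply _ _ MeasurableSet.univ, Set.indicator_univ]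
  exact (congrArg ENNReal.ofReal (mean_one h n)).trans ENNReal.ofReal_one

theorem mean_indicator_cylinder (h : V → SignType → ℝ) (n : ℕ)
    (σ : Config V) (hG : G.IsTree) :
    mean G o J β lam h n ({ω | ∀ i ∈ ball G o n, ω i = σ i}.indicator 1) =
      splittingProb G o J β lam h n σ := by
  rw [mean_eq_sum, Finset.sum_eq_single ((ball G o n).restrict σ)]
  · rw [Set.indicator_of_mem, Pi.one_apply, one_mul]
    · unfold splittingProb
      congr 1
      exact (eq_glue_restrict_of_dependsOn (dependsOn_splittingWeight hG h n) σ 0).symm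
    · intro i hi
      rw [glue_of_mem _ _ hi]; rfl
  · intro τ _ hτ
    rw [Set.indicator_of_notMem, zero_mul]
    intro h
    refine hτ (funext fun i => ?_)
    have := h i i.2
    rwa [glue_of_mem _ _ i.2] at this
  · intro h
    exact absurd (Finset.mem_univ _) h

/-- The marginal on a finite set `I` is read off from a ball `N I` containing it. By `hcons` any
larger ball gives the same marginal, so two sets can be compared inside a common ball. -/
theorem exists_isSplittingGibbs (hG : G.IsTree) {h : V → SignType → ℝ}
    (hcons : ∀ n m, 1 ≤ n → n ≤ m → ∀ f : Config V → ℝ, DependsOn f (ball G o n) →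
      mean G o J β lam h m f = mean G o J β lam h n f) :
    ∃ μ, IsSplittingGibbs G o J β lam h μ := by
  choose N hN1 hN using fun I : Finset V => exists_subset_ball_ge (o := o) hG I 1
  have hdep : ∀ (I : Finset V) (T : Set (I → SignType)),
      DependsOn ((I.restrict ⁻¹' T).indicator (1 : Config V → ℝ)) I := by
    intro I T ω ω' hω
    have : I.restrict ω = I.restrict ω' := funext fun i => hω i i.2
    simp only [Set.indicator, Set.mem_preimage, this, Pi.one_apply]
  have hmap : ∀ I n, N I ≤ n → ((finiteMeasure G o J β lam h n).map I.restrict :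
      Measure (I → SignType)) = (finiteMeasure G o J β lam h (N I)).map I.restrict := by
    intro I n hn
    ext T hT
    have hT' : MeasurableSet (I.restrict ⁻¹' T : Set (Config V)) :=
      (show Measurable (I.restrict : Config V → _) by fun_prop) hT
    rw [Measure.map_apply (by fun_prop) hT, Measure.map_apply (by fun_prop) hT,
      finiteMeasure_apply _ _ hT', finiteMeasure_apply _ _ hT',
      hcons _ _ (hN1 I) hn _ ((hdep I T).mono (Finset.coe_subset.2 (hN I)))]
  have hprob : ∀ I : Finset V, IsProbabilityMeasure
      ((finiteMeasure G o J β lam h (N I)).map I.restrict : Measure (I → SignType)) :=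
    fun I => Measure.isProbabilityMeasure_map (by fun_prop)
  obtain ⟨μ, hμ⟩ := exists_isProjectiveLimit_of_finite
    (P := fun I : Finset V => (finiteMeasure G o J β lam h (N I)).map I.restrict) (by
      intro I K hKI
      beta_reduce
      rw [← hmap I (max (N I) (N K)) (le_max_left _ _),
        ← hmap K (max (N I) (N K)) (le_max_right _ _), Measure.map_map (by fun_prop) (by fun_prop)]
      rfl)
  refine ⟨μ, hμ.isProbabilityMeasure, fun n hn σ => ?_⟩
  set T : Set (ball G o n → SignType) := {τ | ∀ i, τ i = σ i}
  have hT : {ω : Config V | ∀ i ∈ ball G o n, ω i = σ i} = (ball G o n).restrict ⁻¹' T := by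
    ext ω
    simp [T]
  have hTm : MeasurableSet T := T.toFinite.measurableSet
  have hT' : MeasurableSet ((ball G o n).restrict ⁻¹' T : Set (Config V)) :=
    (show Measurable ((ball G o n).restrict : Config V → _) by fun_prop) hTm
  rw [← mean_indicator_cylinder h n σ hG, hT, ← Measure.map_apply (by fun_prop) hTm, hμ]
  beta_reduce
  rw [← hmap _ _ (le_max_left _ n), Measure.map_apply (by fun_prop) hTm,
    finiteMeasure_apply _ _ hT', hcons n _ hn (le_max_right _ _) _ (hdep _ T)]

/-! ### The DLR equations -/

theorem dependsOn_compl_gibbsSpec (Λ : Finset V) (A : Set (Config V)) :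
    DependsOn (fun ω => gibbsSpec G J β lam Λ ω A) (Λ : Set V)ᶜ := by
  intro ω ω' h
  simp only [gibbsSpec_eq]
  rw [dependsOn_compl_cfgSum Λ _ h, dependsOn_compl_cfgSum Λ
    (fun ω => Real.exp (-β * energy J β lam (touchingEdges G Λ) Λ ω)) h]

theorem touchingEdges_mono {Λ Δ : Finset V} (h : Λ ⊆ Δ) :
    touchingEdges G Λ ⊆ touchingEdges G Δ := Finset.biUnion_subset_biUnion_of_subset_left _ h

theorem dependsOn_energy_touchingEdges (hG : G.IsTree) {n : ℕ} {Λ : Finset V}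
    (hΛ : Λ ⊆ ball G o n) :
    DependsOn (energy J β lam (touchingEdges G Λ) Λ) (ball G o (n + 1)) := by
  refine dependsOn_energy J β lam (fun v w h => ?_)
    (Finset.coe_subset.2 (hΛ.trans (ball_mono hG (Nat.le_succ n))))
  have := touchingEdges_mono hΛ h
  rw [touchingEdges_ball hG, mk_mem_innerEdges] at this
  exact ⟨this.1, this.2.1⟩

/-- The extra layer matters: with `Λ` in the ball of radius `n`, every edge touching `Λ` lies in the
ball of radius `n + 1`, and the fields on the outer sphere do not see `Λ`. -/
theorem splittingWeight_eq_mul (hG : G.IsTree) (h : V → SignType → ℝ) {n : ℕ} {Λ : Finset V}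
    (hΛ : Λ ⊆ ball G o n) :
    ∃ r : Config V → ℝ, DependsOn r (Λ : Set V)ᶜ ∧ ∀ ω,
      splittingWeight G o J β lam h (n + 1) ω =
        r ω * Real.exp (-β * energy J β lam (touchingEdges G Λ) Λ ω) := by
  have hE : touchingEdges G Λ ⊆ innerEdges G (ball G o (n + 1)) := by
    rw [← touchingEdges_ball hG]
    exact touchingEdges_mono hΛ
  have hB : Λ ⊆ ball G o (n + 1) := hΛ.trans (ball_mono hG (Nat.le_succ n))
  refine ⟨fun ω => Real.exp (-β * energy J β lam (innerEdges G (ball G o (n + 1)) \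
    touchingEdges G Λ) (ball G o (n + 1) \ Λ) ω + ∑ i ∈ sphere G o (n + 1), h i (ω i)), ?_, ?_⟩
  · have hdep : DependsOn (energy J β lam (innerEdges G (ball G o (n + 1)) \ touchingEdges G Λ)
        (ball G o (n + 1) \ Λ)) (Λ : Set V)ᶜ := by
      refine dependsOn_energy J β lam (fun v w hvw => ?_) fun v hv => (Finset.mem_sdiff.1 hv).2
      obtain ⟨h1, h2⟩ := Finset.mem_sdiff.1 hvw
      rw [mk_mem_innerEdges] at h1
      rw [mk_mem_touchingEdges] at h2
      simp only [Set.mem_compl_iff, Finset.mem_coe]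
      tauto
    intro ω ω' hω
    simp only
    rw [hdep hω]
    congr 2
    refine Finset.sum_congr rfl fun i hi => ?_
    rw [hω i fun hi' => Finset.disjoint_left.1 (disjoint_ball_sphere hG n) (hΛ hi') hi]
  · intro ω
    rw [splittingWeight, ← Real.exp_add]
    congr 1
    simp only [energy_eq]
    rw [← Finset.sum_sdiff hE, ← Finset.sum_sdiff hB]
    ring

/-- The DLR equations in a finite volume. -/
theorem mean_gibbsSpec (hG : G.IsTree) (h : V → SignType → ℝ) {n : ℕ} {Λ : Finset V}
    (hΛ : Λ ⊆ ball G o n) (A : Set (Config V)) :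
    mean G o J β lam h (n + 1) (fun ω => gibbsSpec G J β lam Λ ω A) =
      mean G o J β lam h (n + 1) (A.indicator 1) := by
  obtain ⟨r, hr, hw⟩ := splittingWeight_eq_mul (J := J) (β := β) (lam := lam) hG h hΛ
  have hB : Λ ⊆ ball G o (n + 1) := hΛ.trans (ball_mono hG (Nat.le_succ n))
  have hdisj : Disjoint (Λ : Set V)ᶜ Λ := disjoint_compl_left
  unfold mean
  congr 1
  rw [← Finset.sdiff_union_of_subset hB, cfgSum_union Finset.sdiff_disjoint,
    cfgSum_union Finset.sdiff_disjoint]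
  congr 1
  funext ω
  simp only [hw]
  rw [cfgSum_mul_left (dependsOn_compl_gibbsSpec Λ A) hdisj, cfgSum_mul_left hr hdisj]
  -- With the spins off `Λ` frozen, `r` factors out on both sides. The remaining sum of Boltzmann
  -- weights over `Λ` cancels the denominator of `gibbsSpec`.
  simp only [mul_left_comm _ (r _)]
  rw [cfgSum_mul_left hr hdisj, gibbsSpec_eq, div_mul_cancel₀]
  exact (cfgSum_pos (fun ω => Real.exp_pos _) ω).ne'

theorem measurable_gibbsWeight (hG : G.IsTree) (Λ : Finset V) :
    Measurable fun ω => Real.exp (-β * energy J β lam (touchingEdges G Λ) Λ ω) := by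
  obtain ⟨n, hn⟩ := exists_subset_ball (o := hG.connected.nonempty.some) hG Λ
  exact measurable_of_dependsOn (Λ := ball G hG.connected.nonempty.some (n + 1)) fun ω ω' h => by
    rw [dependsOn_energy_touchingEdges hG hn h]

theorem gibbsSpec_nonneg (Λ : Finset V) (ω : Config V) (A : Set (Config V)) :
    0 ≤ gibbsSpec G J β lam Λ ω A := by
  rw [gibbsSpec_eq]
  exact div_nonneg (cfgSum_nonneg (fun ω => mul_nonneg
    (Set.indicator_nonneg (fun _ _ => zero_le_one) _) (Real.exp_pos _).le) _)
    (cfgSum_nonneg (fun _ => (Real.exp_pos _).le) _)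

/-- The mixture `∫ γ_Λ(· | ω) μ(dω)` is a measure. -/
theorem exists_measure_lintegral_gibbsSpec (hG : G.IsTree) (Λ : Finset V)
    (μ : Measure (Config V)) :
    ∃ ν : Measure (Config V), ∀ A, MeasurableSet A →
      ν A = ∫⁻ ω, ENNReal.ofReal (gibbsSpec G J β lam Λ ω A) ∂μ := by
  set w : Config V → ℝ := fun ω => Real.exp (-β * energy J β lam (touchingEdges G Λ) Λ ω)
  have hw : Measurable w := measurable_gibbsWeight hG Λ
  have hZ : Measurable (cfgSum Λ w) :=
    Finset.measurable_sum _ fun τ _ => hw.comp (measurable_glue Λ τ)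
  set q : (Λ → SignType) → Config V → ℝ := fun τ ω => w (glue Λ τ ω) / cfgSum Λ w ω
  have hq : ∀ τ, Measurable (q τ) := fun τ => (hw.comp (measurable_glue Λ τ)).div hZ
  refine ⟨∑ τ, (μ.withDensity fun ω => ENNReal.ofReal (q τ ω)).map (glue Λ τ), fun A hA => ?_⟩
  rw [Measure.finsetSum_apply]
  have hspec : ∀ ω, ENNReal.ofReal (gibbsSpec G J β lam Λ ω A) =
      ∑ τ, (glue Λ τ ⁻¹' A).indicator (fun ω => ENNReal.ofReal (q τ ω)) ω := by
    intro ω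
    rw [gibbsSpec_eq, cfgSum, Finset.sum_div, ENNReal.ofReal_sum_of_nonneg]
    · refine Finset.sum_congr rfl fun τ _ => ?_
      by_cases h : glue Λ τ ω ∈ A
      · simp [h, q, w]
      · simp [h]
    · exact fun τ _ => div_nonneg (mul_nonneg (Set.indicator_nonneg (fun _ _ => zero_le_one) _)
        (Real.exp_pos _).le) (cfgSum_nonneg (fun _ => (Real.exp_pos _).le) _)
  simp only [hspec]
  rw [lintegral_finsetSum _ fun τ _ =>
    (hq τ).ennreal_ofReal.indicator (measurable_glue Λ τ hA)]
  refine Finset.sum_congr rfl fun τ _ => ?_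
  rw [Measure.map_apply (measurable_glue Λ τ) hA, withDensity_apply _ (measurable_glue Λ τ hA),
    lintegral_indicator (measurable_glue Λ τ hA)]

theorem dependsOn_gibbsSpec (hG : G.IsTree) {n : ℕ} {Λ : Finset V} (hΛ : Λ ⊆ ball G o n)
    {A : Set (Config V)} (hA : DependsOn (A.indicator (1 : Config V → ℝ)) (ball G o (n + 1))) :
    DependsOn (fun ω => gibbsSpec G J β lam Λ ω A) (ball G o (n + 1)) := by
  have hE := dependsOn_energy_touchingEdges (J := J) (β := β) (lam := lam) hG hΛ
  intro ω ω' h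
  simp only [gibbsSpec_eq]
  congr 1
  · refine dependsOn_cfgSum (Δ := ball G o (n + 1)) (fun η η' h => ?_) h
    simp only [hE h, hA h]
  · refine dependsOn_cfgSum (Δ := ball G o (n + 1)) (fun η η' h => ?_) h
    simp only [hE h]

/-- Both sides of the DLR equation are measures in the event, so increasing cylinders suffice. For
these both sides are means in a ball, where `mean_gibbsSpec` applies. -/
theorem IsSplittingGibbs.isGibbs (hG : G.IsTree) {h : V → SignType → ℝ} {μ : Measure (Config V)}
    (hμ : IsSplittingGibbs G o J β lam h μ) : IsGibbs G J β lam μ := by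
  have := hμ.1
  refine ⟨hμ.1, fun Λ => ?_⟩
  obtain ⟨ν, hν⟩ := exists_measure_lintegral_gibbsSpec (J := J) (β := β) (lam := lam) hG Λ μ
  suffices μ = ν by
    intro A hA
    rw [← hν A hA, this]
  refine ext_of_upperCylinder fun Δ σ => ?_
  obtain ⟨n, hn, hΔ⟩ := exists_subset_ball_ge (o := o) hG (Λ ∪ Δ) 1
  have hA : DependsOn ((upperCylinder Δ σ).indicator (1 : Config V → ℝ)) (ball G o (n + 1)) :=
    (dependsOn_upperCylinder Δ σ).mono (Finset.coe_subset.2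
      ((Finset.subset_union_right.trans hΔ).trans (ball_mono hG (Nat.le_succ n))))
  have hΛ := Finset.subset_union_left.trans hΔ
  rw [hν _ (measurableSet_of_dependsOn (dependsOn_upperCylinder Δ σ)),
    hμ.lintegral_eq (by lia : 1 ≤ n + 1) (fun ω => gibbsSpec_nonneg Λ ω _)
      (dependsOn_gibbsSpec hG hΛ hA), mean_gibbsSpec hG h hΛ, hμ.measure_eq (by lia) hA]

/-! ### Translation-invariant splitting Gibbs measures -/

/-- The pair `(x, y)` fixes the fields only up to an additive constant. Since the constant cancels,
they may be normalised to vanish at spin 0, as in `lawField`. -/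
theorem splittingProb_add_const (h : SignType → ℝ) (c : ℝ) (n : ℕ) (ω : Config V) :
    splittingProb G o J β lam (fun _ s => c + h s) n ω =
      splittingProb G o J β lam (fun _ => h) n ω := by
  have hw : ∀ ω, splittingWeight G o J β lam (fun _ s => c + h s) n ω =
      Real.exp ((sphere G o n).card * c) * splittingWeight G o J β lam (fun _ => h) n ω := by
    intro ω
    simp only [splittingWeight, Finset.sum_add_distrib, Finset.sum_const, nsmul_eq_mul,
      ← Real.exp_add]
    congr 1
    ring
  simp only [splittingProb, hw, ← Finset.mul_sum]
  exact mul_div_mul_left _ _ (Real.exp_ne_zero _)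

theorem isTISGM_iff (hlam : 0 < lam) {x y : ℝ} (hx : 0 < x) (hy : 0 < y)
    {μ : Measure (Config V)} :
    IsTISGM G o J β lam x y μ ↔
      IsSplittingGibbs G o J β lam (fun _ => lawField lam (x, y)) μ := by
  constructor
  · rintro ⟨h, rfl, rfl, hμ, hμ'⟩
    refine ⟨hμ, fun n hn σ => ?_⟩
    rw [hμ' n hn, ← splittingProb_add_const (lawField _ _) (h 0)]
    congr 2
    funext _ s
    rcases s with _ | _ | _ <;> simp [lawField, hlam.ne']
  · intro hμ
    refine ⟨lawField lam (x, y), ?_, ?_, hμ⟩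
    · simp only [lawField, if_true, show ¬ ((0 : SignType) = 1) by decide,
        show ¬ ((0 : SignType) = -1) by decide, if_false, sub_zero]
      rw [Real.exp_log (div_pos hx hlam), mul_div_cancel₀ _ hlam.ne']
    · simp only [lawField, if_true, show ¬ ((0 : SignType) = 1) by decide,
        show ¬ ((-1 : SignType) = 1) by decide,
        show ¬ ((0 : SignType) = -1) by decide, if_false, sub_zero]
      rw [Real.exp_log (div_pos hy hlam), mul_div_cancel₀ _ hlam.ne']

theorem exists_isSplittingGibbs_of_isBoundaryLaw {k : ℕ} (hG : IsRootedCayleyTree G o k)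
    (hβ : 0 < β) (hlam : 0 < lam) {x y : ℝ}
    (hxy : IsBoundaryLaw k (Real.exp (-J * β)) lam x y) :
    ∃ μ, IsSplittingGibbs G o J β lam (fun _ => lawField lam (x, y)) μ := by
  obtain ⟨hx, hy, hfix⟩ := isBoundaryLaw_iff.1 hxy
  refine exists_isSplittingGibbs hG.1 fun n m hn hnm f hf => ?_
  obtain ⟨j, rfl⟩ := Nat.exists_eq_add_of_le hnm
  exact (lawMean_add hG hβ hlam (p := (x, y)) ⟨hx, hy⟩ hn hf j).trans
    (by rw [Function.iterate_fixed hfix])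

/-- On `V_1` the configuration 0 has the same weight under every law, so equal probabilities force
equal partition functions. The configuration 1 then determines a positive power of `p.1 / lam`, with
exponent the size of the nonempty first sphere. -/
theorem fst_eq_of_isSplittingGibbs {k : ℕ} (hk : 0 < k) (hG : IsRootedCayleyTree G o k)
    (hlam : 0 < lam) {p q : ℝ × ℝ} (hp : 0 < p.1) (hq : 0 < q.1) {μ : Measure (Config V)}
    (hμ : IsSplittingGibbs G o J β lam (fun _ => lawField lam p) μ)
    (hμ' : IsSplittingGibbs G o J β lam (fun _ => lawField lam q) μ) : p.1 = q.1 := by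
  have heq : ∀ σ, splittingProb G o J β lam (fun _ => lawField lam p) 1 σ =
      splittingProb G o J β lam (fun _ => lawField lam q) 1 σ := fun σ =>
    (ENNReal.ofReal_eq_ofReal_iff (splittingProb_nonneg _ _ _) (splittingProb_nonneg _ _ _)).1
      ((hμ.2 1 le_rfl σ).symm.trans (hμ'.2 1 le_rfl σ))
  have hconst : ∀ (r : ℝ × ℝ) (s : SignType),
      splittingWeight G o J β lam (fun _ => lawField lam r) 1 (fun _ => s) =
      splittingWeight G o J β lam 0 1 (fun _ => s) *
        Real.exp (lawField lam r s) ^ (sphere G o 1).card := by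
    intro r s
    rw [splittingWeight_eq_mul_prod, Finset.prod_const]
  have h0 := heq fun _ => 0
  have h1 := heq fun _ => 1
  unfold splittingProb at h0 h1
  rw [hconst, hconst] at h0 h1
  have hl0 : ∀ r : ℝ × ℝ, lawField lam r 0 = 0 := fun r => rfl
  have hl1 : ∀ r : ℝ × ℝ, lawField lam r 1 = Real.log (r.1 / lam) := fun r => rfl
  have hw := fun s : SignType => splittingWeight_pos (G := G) (o := o) (J := J) (β := β)
    (lam := lam) 0 1 fun _ => s
  simp only [hl0, Real.exp_zero, one_pow, mul_one] at h0
  rw [hl1, hl1, Real.exp_log (div_pos hp hlam), Real.exp_log (div_pos hq hlam),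
    mul_div_right_comm, mul_div_right_comm] at h1
  rw [div_eq_mul_inv, div_eq_mul_inv] at h0
  have hZ := inv_injective (mul_left_cancel₀ (hw 0).ne' h0)
  rw [hZ] at h1
  have hZpos : 0 < ∑ τ : ball G o 1 → SignType,
      splittingWeight G o J β lam (fun _ => lawField lam q) 1 (glue (ball G o 1) τ 0) :=
    cfgSum_pos (splittingWeight_pos _ 1) 0
  have h2 := mul_left_cancel₀ (div_pos (hw 1) hZpos).ne' h1
  have h3 := (pow_left_inj₀ (div_pos hp hlam).le (div_pos hq hlam).le
    (Finset.card_pos.2 (sphere_one_nonempty hk hG)).ne').1 h2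
  exact (div_left_inj' hlam.ne').1 h3

/-! ### Stochastic domination and extremality -/

/-- For each `j`, the DLR equation in the ball of radius `n + j` and monotonicity bound `ν` by the
all-plus boundary condition. Summing out `j` layers turns that bound into the mean on `V_n` under
the `j`-th iterate, and then `j` tends to infinity. -/
theorem IsGibbs.measure_upperCylinder_le {k : ℕ} (hG : IsRootedCayleyTree G o k) (hJ : 0 < J)
    (hβ : 0 < β) (hlam : 0 < lam) {q : ℝ × ℝ} (hq : 0 < q.1 ∧ 0 < q.2)
    (hlim : Tendsto (fun j => (lawStep k (Real.exp (-J * β)) lam)^[j]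
      (lam, lam * Real.exp (-J * β) ^ k)) atTop (𝓝 q))
    {ν : Measure (Config V)} (hν : IsGibbs G J β lam ν) {n : ℕ} (hn : 1 ≤ n) {Λ : Finset V}
    (hΛ : Λ ⊆ ball G o n) (σ : Config V) :
    ν (upperCylinder Λ σ) ≤
      ENNReal.ofReal (lawMean G o J β lam q n ((upperCylinder Λ σ).indicator 1)) := by
  have := hν.1
  have hA := (dependsOn_upperCylinder Λ σ).mono (Finset.coe_subset.2 hΛ)
  have hp0 : 0 < lam * Real.exp (-J * β) ^ k := by positivity
  refine ge_of_tendsto' ((ENNReal.continuous_ofReal.tendsto _).comp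
    (tendsto_lawMean hlam hq hlim n _)) fun j => ?_
  rw [Function.comp_apply, ← lawMean_add hG hβ hlam ⟨hlam, hp0⟩ hn hA,
    ← gibbsSpec_ball_one hG hlam (by lia)
      (hA.mono (Finset.coe_subset.2 (ball_mono hG.1 (Nat.le_add_right n j)))),
    hν.2 (ball G o (n + j)) _ (measurableSet_of_dependsOn hA)]
  refine (lintegral_mono fun ω => ENNReal.ofReal_le_ofReal
    (gibbsSpec_mono hJ hβ lam _ (isUpperSet_upperCylinder Λ σ)
      (show ω ≤ fun _ => 1 from fun v => SignType.le_one _))).trans ?_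
  rw [lintegral_const, measure_univ, mul_one]

theorem IsGibbs.le_measure_upperCylinder {k : ℕ} (hG : IsRootedCayleyTree G o k) (hJ : 0 < J)
    (hβ : 0 < β) (hlam : 0 < lam) {q : ℝ × ℝ} (hq : 0 < q.1 ∧ 0 < q.2)
    (hlim : Tendsto (fun j => (lawStep k (Real.exp (-J * β)) lam)^[j]
      (lam * Real.exp (-J * β) ^ k, lam)) atTop (𝓝 q))
    {ν : Measure (Config V)} (hν : IsGibbs G J β lam ν) {n : ℕ} (hn : 1 ≤ n) {Λ : Finset V}
    (hΛ : Λ ⊆ ball G o n) (σ : Config V) :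
    ENNReal.ofReal (lawMean G o J β lam q n ((upperCylinder Λ σ).indicator 1)) ≤
      ν (upperCylinder Λ σ) := by
  have := hν.1
  have hA := (dependsOn_upperCylinder Λ σ).mono (Finset.coe_subset.2 hΛ)
  have hp0 : 0 < lam * Real.exp (-J * β) ^ k := by positivity
  refine le_of_tendsto' ((ENNReal.continuous_ofReal.tendsto _).comp
    (tendsto_lawMean hlam hq hlim n _)) fun j => ?_
  rw [Function.comp_apply, ← lawMean_add hG hβ hlam ⟨hp0, hlam⟩ hn hA,
    ← gibbsSpec_ball_neg_one hG hlam (by lia)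
      (hA.mono (Finset.coe_subset.2 (ball_mono hG.1 (Nat.le_add_right n j)))),
    hν.2 (ball G o (n + j)) _ (measurableSet_of_dependsOn hA)]
  refine le_trans ?_ (lintegral_mono fun ω => ENNReal.ofReal_le_ofReal
    (gibbsSpec_mono hJ hβ lam _ (isUpperSet_upperCylinder Λ σ)
      (show (fun _ => -1) ≤ ω from fun v => SignType.neg_one_le _)))
  rw [lintegral_const, measure_univ, mul_one]

/-- A Gibbs measure is extreme if it gives every increasing cylinder event the largest, or the
smallest, probability among all Gibbs measures. -/
theorem isExtremeGibbs_of_upperCylinder {μ : Measure (Config V)} (hμ : IsGibbs G J β lam μ)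
    (h : ∀ Λ σ, (∀ ν, IsGibbs G J β lam ν → ν (upperCylinder Λ σ) ≤ μ (upperCylinder Λ σ)) ∨
      ∀ ν, IsGibbs G J β lam ν → μ (upperCylinder Λ σ) ≤ ν (upperCylinder Λ σ)) :
    IsExtremeGibbs G J β lam μ := by
  refine ⟨hμ, fun ν₁ hν₁ ν₂ hν₂ hseg => ?_⟩
  obtain ⟨a, b, ha, hb, hab, heq⟩ := hseg
  have := hν₁.1
  have := hν₂.1
  have := hμ.1
  refine ext_of_upperCylinder fun Λ σ => ?_
  set A := upperCylinder Λ σ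
  have hA : (a : ℝ) * ν₁.real A + b * ν₂.real A = μ.real A := by
    rw [← heq, measureReal_add_apply, measureReal_nnreal_smul_apply, measureReal_nnreal_smul_apply]
  have hab' : (a : ℝ) + b = 1 := by exact_mod_cast hab
  have ha' : (0 : ℝ) < a := ha
  have hb' : (0 : ℝ) < b := hb
  suffices hreal : ν₁.real A = μ.real A by
    rwa [measureReal_eq_measureReal_iff] at hreal
  -- When `μ` attains an extreme value at `A`, the two summands have the same sign, so both vanish.
  have hconv : (a : ℝ) * (ν₁.real A - μ.real A) + b * (ν₂.real A - μ.real A) = 0 := by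
    linear_combination hA - μ.real A * hab'
  rcases h Λ σ with h | h
  · have h1 : ν₁.real A ≤ μ.real A := ENNReal.toReal_mono (measure_ne_top _ _) (h ν₁ hν₁)
    have h2 : ν₂.real A ≤ μ.real A := ENNReal.toReal_mono (measure_ne_top _ _) (h ν₂ hν₂)
    nlinarith
  · have h1 : μ.real A ≤ ν₁.real A := ENNReal.toReal_mono (measure_ne_top _ _) (h ν₁ hν₁)
    have h2 : μ.real A ≤ ν₂.real A := ENNReal.toReal_mono (measure_ne_top _ _) (h ν₂ hν₂)
    nlinarith

end

end WidomRowlinson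

theorem mainTheorem8 {V : Type*} (G : SimpleGraph V) [G.LocallyFinite] (o : V) (k : ℕ)
    (hk : k = 2 ∨ k = 3) (hG : WidomRowlinson.IsRootedCayleyTree G o k)
    (J β lam : ℝ) (hJ : 0 < J) (hβ : 0 < β)
    (hθ : Real.exp (-J * β) < WidomRowlinson.thetaCr k)
    (hlam : WidomRowlinson.lambdaCr k (Real.exp (-J * β)) < lam) :
    ∃ x₁ x₂ : ℝ, x₁ < x₂ ∧
      (∀ x y : ℝ, (WidomRowlinson.IsBoundaryLaw k (Real.exp (-J * β)) lam x y ∧ x ≠ y) ↔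
        (x = x₁ ∧ y = x₂) ∨ (x = x₂ ∧ y = x₁)) ∧
      ∃ μ₁ μ₂ : MeasureTheory.Measure (WidomRowlinson.Config V),
        (∀ μ, WidomRowlinson.IsTISGM G o J β lam x₁ x₂ μ ↔ μ = μ₁) ∧
        (∀ μ, WidomRowlinson.IsTISGM G o J β lam x₂ x₁ μ ↔ μ = μ₂) ∧
        μ₁ ≠ μ₂ ∧
        WidomRowlinson.IsExtremeGibbs G J β lam μ₁ ∧
        WidomRowlinson.IsExtremeGibbs G J β lam μ₂ := by
  open WidomRowlinson in
  have hθ0 : 0 < Real.exp (-J * β) := Real.exp_pos _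
  have hθ1 : Real.exp (-J * β) < 1 := by
    rw [Real.exp_lt_one_iff]
    nlinarith [mul_pos hJ hβ]
  have hk0 : 0 < k := by rcases hk with rfl | rfl <;> norm_num
  -- Used only for `0 < lam`, which follows from `lam = c ^ k`.
  obtain ⟨c, hc, hck, -⟩ := existsUnique_rootSystem hk hθ0 hθ hlam
  have hlam0 : 0 < lam := hck ▸ pow_pos hc k
  obtain ⟨x₁, x₂, hlt, H⟩ := exists_asymmetric_boundaryLaw hk hθ0 hθ hlam
  have hlaw₁ := ((H x₁ x₂).2 (Or.inl ⟨rfl, rfl⟩)).1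
  have hlaw₂ := ((H x₂ x₁).2 (Or.inr ⟨rfl, rfl⟩)).1
  have hx₁ : 0 < x₁ := hlaw₁.1
  have hx₂ : 0 < x₂ := hlaw₁.2.1
  have hlim₂ := tendsto_iterate_lawStep hθ0 hθ1 hlam0 hlt H
  have hlim₁ := tendsto_iterate_lawStep_swap hlim₂
  obtain ⟨μ₁, hμ₁⟩ := exists_isSplittingGibbs_of_isBoundaryLaw hG hβ hlam0 hlaw₁
  obtain ⟨μ₂, hμ₂⟩ := exists_isSplittingGibbs_of_isBoundaryLaw hG hβ hlam0 hlaw₂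
  refine ⟨x₁, x₂, hlt, H, μ₁, μ₂, fun μ => ?_, fun μ => ?_, ?_, ?_, ?_⟩
  · rw [isTISGM_iff hlam0 hx₁ hx₂]
    exact ⟨fun h => h.unique hG.1 hμ₁, fun h => h ▸ hμ₁⟩
  · rw [isTISGM_iff hlam0 hx₂ hx₁]
    exact ⟨fun h => h.unique hG.1 hμ₂, fun h => h ▸ hμ₂⟩
  · rintro rfl
    exact hlt.ne (fst_eq_of_isSplittingGibbs hk0 hG hlam0 (p := (x₁, x₂)) (q := (x₂, x₁))
      hx₁ hx₂ hμ₁ hμ₂)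
  -- The law `(x₁, x₂)` is the limit from the all-minus boundary condition, so `μ₁` is the smallest
  -- Gibbs measure on increasing cylinders.
  · refine isExtremeGibbs_of_upperCylinder (hμ₁.isGibbs hG.1) fun Λ σ => Or.inr fun ν hν => ?_
    obtain ⟨n, hn, hΛ⟩ := exists_subset_ball_ge (o := o) hG.1 Λ 1
    rw [hμ₁.measure_eq hn ((dependsOn_upperCylinder Λ σ).mono (Finset.coe_subset.2 hΛ))]
    exact hν.le_measure_upperCylinder hG hJ hβ hlam0 (q := (x₁, x₂)) ⟨hx₁, hx₂⟩ hlim₁ hn hΛ σ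
  · refine isExtremeGibbs_of_upperCylinder (hμ₂.isGibbs hG.1) fun Λ σ => Or.inl fun ν hν => ?_
    obtain ⟨n, hn, hΛ⟩ := exists_subset_ball_ge (o := o) hG.1 Λ 1
    rw [hμ₂.measure_eq hn ((dependsOn_upperCylinder Λ σ).mono (Finset.coe_subset.2 hΛ))]
    exact hν.measure_upperCylinder_le hG hJ hβ hlam0 (q := (x₂, x₁)) ⟨hx₂, hx₁⟩ hlim₂ hn hΛ σ
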